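/- Let $\mathcal X,\mathcal Y,\mathcal Z$ be finite alphabets; logarithms are natural. Definitions. A metric is a function $q:\mathcal X\times\mathcal Y\to\mathbb R$, extended to sequences by $q(\mathbf x,\mathbf y)=\frac1n\sum_{i=1}^n q(x_i,y_i)$. For a channel $W=W_{Y|X}$ and a codebook $\mathcal C\subseteq\mathcal X^n$, let $P_e(q,W,\mathcal C)$ be the average error probability, for equiprobable messages sent over the memoryless channel $W^n(\mathbf y|\mathbf x)=\prod_i W(y_i|x_i)$, of the decoder that outputs a codeword maximizing $q(\cdot,\mathbf y)$, ties being broken uniformly between the maximizers. For an $n$-type $P$ (an empirical distribution $\widehat P_{\mathbf x}$ of a sequence $\mathbf x\in\mathcal X^n$) with type class $\mathcal T_n(P)=\{\mathbf x\in\mathcal X^n:\widehat P_{\mathbf x}=P\}$, and $R\in\mathbb R$, let $$e_n^q(R,P,W)=\max_{\mathcal C\subseteq\mathcal T_n(P):\,|\mathcal C|\ge e^{nR}}-\tfrac1n\log P_e(q,W,\mathcal C).$$ For a distribution $P$ on $\mathcal X$, let $\mathcal W_q(P)$ be the set of two-output channels $P_{YZ|X}$ from $\mathcal X$ to $\mathcal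 Y\times\mathcal Z$ such that, with $P_{XYZ}=P\times P_{YZ|X}$, $$\min_V\ \mathbb E_V\,q(\widetilde X,Y)\ \ge\ \mathbb E_{P_{XYZ}}\,q(X,Y),$$ where the minimum is over all joint distributions $V=V_{U\widetilde XXZY}$, with $\widetilde X$ taking values in $\mathcal X$ and an auxiliary variable $U$ of alphabet size at most $|\mathcal X|^2|\mathcal Z|$, such that $V_{XZY}=P_{XZY}$, $V_{U\widetilde XXZ}(u,x_1,x_2,z)=V_{U\widetilde XXZ}(u,x_2,x_1,z)$ for all $(u,x_1,x_2,z)$, and $\widetilde X-(U,Z)-X$ and $(\widetilde X,U)-(X,Z)-Y$ are Markov chains. Let $$E_{sp}^q(R,P,W)=\min_{P_{YZ|X}\in\mathcal W_q(P):\ I(X;Z)\le R} D(P_{Y|X}\|W|P),$$ where $I(X;Z)$ is computed under $P\times P_{Z|X}$ and $D(V\|W|P)=\sum_{x,y}P(x)V(y|x)\log\frac{V(y|x)}{W(y|x)}\in[0,\infty]$. The minimum and the maximum over the empty set are $+\infty$ and $-\infty$, and $-\log 0=+\infty$. Theorem. There is a real sequence $\epsilon_{n,a}=O\!\left(\frac{\log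 n}{n}\right)$, depending only on the alphabets, and for every $w>0$ there is a real sequence $\epsilon_{n,b}=O\!\left(\frac{\log n}{n}\right)$, depending only on the alphabets and on $w$, such that for every channel $W$ from $\mathcal X$ to $\mathcal Y$ whose positive transition probabilities are all at least $w$, every metric $q:\mathcal X\times\mathcal Y\to\mathbb R$, every $n\ge1$, every $n$-type $P$ on $\mathcal X$ and every $R\in\mathbb R$, $$e_n^q(R,P,W)\ \le\ E_{sp}^q(R-\epsilon_{n,a},P,W)+\epsilon_{n,b}.$$ -/

import Mathlib

noncomputable section

namespace MismatchedDecoding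

/-- `W` is a channel (conditional probability mass function) from `A` to the finite set `B`:
`W a b` is the probability of the output `b` given the input `a`. -/
def IsChannel {A B : Type*} [Fintype B] (W : A → B → ℝ) : Prop :=
  ∀ a, W a ∈ stdSimplex ℝ B

open Classical in
/-- The empirical distribution (type) of a sequence `x` of length `n`. -/
def empirical {A : Type*} {n : ℕ} (x : Fin n → A) (a : A) : ℝ :=
  ((Finset.univ.filter fun i => x i = a).card : ℝ) / n

/-- `P` is an `n`-type: the empirical distribution of some sequence of length `n`. -/
def IsType {A : Type*} (n : ℕ) (P : A → ℝ) : Prop :=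
  ∃ x : Fin n → A, empirical x = P

/-- The memoryless extension of a channel to sequences of length `n`. -/
def chanPow {X Y : Type*} (W : X → Y → ℝ) {n : ℕ} (x : Fin n → X) (y : Fin n → Y) : ℝ :=
  ∏ i, W (x i) (y i)

/-- The additive metric on sequences which is induced by the single-letter metric `q`. -/
def seqMetric {X Y : Type*} (q : X → Y → ℝ) {n : ℕ} (x : Fin n → X) (y : Fin n → Y) : ℝ :=
  (1 / (n : ℝ)) * ∑ i, q (x i) (y i)

open Classical in
/-- The codewords of `C` of largest metric with the received sequence `y`. -/
def maximizers {X Y : Type*} (q : X → Y → ℝ) {n : ℕ} (C : Finset (Fin n → X))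
    (y : Fin n → Y) : Finset (Fin n → X) :=
  C.filter fun x => ∀ x' ∈ C, seqMetric q x' y ≤ seqMetric q x y

open Classical in
/-- The probability that the decoder outputs the codeword `x` when `y` is received; ties are
broken uniformly between the maximizers of the metric. -/
def decodeProb {X Y : Type*} (q : X → Y → ℝ) {n : ℕ} (C : Finset (Fin n → X))
    (y : Fin n → Y) (x : Fin n → X) : ℝ :=
  if x ∈ maximizers q C y then 1 / ((maximizers q C y).card : ℝ) else 0

/-- The average error probability of the codebook `C` (equiprobable messages) over the memoryless
channel `W` with decoding metric `q`. -/
def errorProb {X Y : Type*} [Fintype Y] (q : X → Y → ℝ) (W : X → Y → ℝ) {n : ℕ}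
    (C : Finset (Fin n → X)) : ℝ :=
  (1 / (C.card : ℝ)) * ∑ x ∈ C, ∑ y : Fin n → Y, chanPow W x y * (1 - decodeProb q C y x)

/-- `-(1/n) log p`, with the value `∞` at `p = 0`. -/
def exponent (n : ℕ) (p : ℝ) : EReal :=
  if p = 0 then ⊤ else ((-(1 / (n : ℝ)) * Real.log p : ℝ) : EReal)

/-- The highest exponent of the average error probability among the codebooks of block length `n`
with constant composition `P` and at least `exp (n R)` codewords (`-∞` if there are none). -/
def bestExponent {X Y : Type*} [Fintype Y] (q : X → Y → ℝ) (n : ℕ) (R : ℝ) (P : X → ℝ)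
    (W : X → Y → ℝ) : EReal :=
  ⨆ C ∈ {C : Finset (Fin n → X) |
      (∀ x ∈ C, empirical x = P) ∧ Real.exp (n * R) ≤ (C.card : ℝ)},
    exponent n (errorProb q W C)

/-- The mutual information of a joint distribution on `A × B` (natural logarithm). -/
def mutualInfo {A B : Type*} [Fintype A] [Fintype B] (J : A → B → ℝ) : ℝ :=
  ∑ a, ∑ b, J a b * Real.log (J a b / ((∑ b', J a b') * (∑ a', J a' b)))

open Classical in
/-- The conditional divergence `D(V‖W|P)`, with the value `∞` if `P × V` is not absolutely
continuous with respect to `P × W`. -/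
def condDiv {X Y : Type*} [Fintype X] [Fintype Y] (V W : X → Y → ℝ) (P : X → ℝ) : EReal :=
  if ∀ x y, P x * W x y = 0 → P x * V x y = 0 then
    ((∑ x, ∑ y, P x * V x y * Real.log (V x y / W x y) : ℝ) : EReal)
  else ⊤

/-- The marginal channel to `Y` of a two-output channel to `Y × Z`. -/
def margY {X Y Z : Type*} [Fintype Z] (Q : X → Y × Z → ℝ) (x : X) (y : Y) : ℝ :=
  ∑ z, Q x (y, z)

/-- The marginal channel to `Z` of a two-output channel to `Y × Z`. -/
def margZ {X Y Z : Type*} [Fintype Y] (Q : X → Y × Z → ℝ) (x : X) (z : Z) : ℝ :=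
  ∑ y, Q x (y, z)

/-- The joint distributions `V` of `(U, X', X, Z, Y)` over which the metric is minimized in the
definition of the class of two-output channels below; `X'` is the competing symbol. -/
structure Admissible {U X Y Z : Type*} [Fintype U] [Fintype X] [Fintype Y] [Fintype Z]
    (P : X → ℝ) (Q : X → Y × Z → ℝ) (V : U × X × X × Z × Y → ℝ) : Prop where
  /-- `V` is a probability distribution. -/
  mem_simplex : V ∈ stdSimplex ℝ (U × X × X × Z × Y)
  /-- The marginal of `(X, Z, Y)` is the one induced by `P` and `Q`. -/
  marginal : ∀ x z y, ∑ u, ∑ x', V (u, x', x, z, y) = P x * Q x (y, z)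
  /-- The law of `(U, X', X, Z)` is symmetric in `X'` and `X`. -/
  symmetric : ∀ u x' x z, ∑ y, V (u, x', x, z, y) = ∑ y, V (u, x, x', z, y)
  /-- The Markov chain `X' - (U, Z) - X`. -/
  markov_left : ∀ u x' x z,
    (∑ y, V (u, x', x, z, y)) * (∑ a, ∑ b, ∑ y, V (u, a, b, z, y)) =
      (∑ b, ∑ y, V (u, x', b, z, y)) * (∑ a, ∑ y, V (u, a, x, z, y))
  /-- The Markov chain `(X', U) - (X, Z) - Y`. -/
  markov_right : ∀ u x' x z y,
    V (u, x', x, z, y) * (∑ u', ∑ a, ∑ y', V (u', a, x, z, y')) =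
      (∑ y', V (u, x', x, z, y')) * (∑ u', ∑ a, V (u', a, x, z, y))

/-- The class `𝒲_q(P)` of two-output channels `P_{YZ|X}` for which every admissible `V`, with an
auxiliary alphabet of size at most `|X|² |Z|`, satisfies `E q(X', Y) ≥ E q(X, Y)`. -/
def twoOutputClass {X Y Z : Type*} [Fintype X] [Fintype Y] [Fintype Z] (q : X → Y → ℝ)
    (P : X → ℝ) : Set (X → Y × Z → ℝ) :=
  {Q | IsChannel Q ∧
    ∀ k : ℕ, k ≤ Fintype.card X ^ 2 * Fintype.card Z →
      ∀ V : Fin k × X × X × Z × Y → ℝ, Admissible P Q V →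
        ∑ u, ∑ x', ∑ x, ∑ z, ∑ y, V (u, x', x, z, y) * q x y ≤
          ∑ u, ∑ x', ∑ x, ∑ z, ∑ y, V (u, x', x, z, y) * q x' y}

/-- The sphere-packing type function `E_sp^q(R, P, W)` for the auxiliary output alphabet `Z`
(`∞` if no two-output channel satisfies the constraints). -/
def spherePacking {X Y : Type*} (Z : Type*) [Fintype X] [Fintype Y] [Fintype Z]
    (q : X → Y → ℝ) (R : ℝ) (P : X → ℝ) (W : X → Y → ℝ) : EReal :=
  ⨅ Q ∈ {Q : X → Y × Z → ℝ |
      Q ∈ twoOutputClass q P ∧ mutualInfo (fun x z => P x * margZ Q x z) ≤ R},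
    condDiv (margY Q) W P

end MismatchedDecoding

end

/-!
The bound is proved code by code: given a code `C` of composition `P` with at least `exp (n R)`
words and a two-output channel `Q` in the class `𝒲_q(P)` with `I(X;Z)` slightly below `R`, the
error probability over `W` is at least `exp (-n D(P_{Y|X}‖W|P) - O(log n))`. A side sequence `z` of
joint type about `P × P_{Z|X}` with a codeword `x` is used to find a competing codeword `x'`, and
then outputs `y` that are typical under `Q` for `(x, z)` and that the decoder attributes to `x'` at
least as readily as to `x`. All quantities have to be controlled up to polynomial factors, although
membership in the class is not stable under perturbations of `Q`. Two devices deal with this.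

*Rounding as mixing* (`mem_convexHull_roundings`). A real array with integral row sums is a mixture
of integral arrays at distance at most one. So if every joint type `J` near `n P × P_{Z|X}` admitted
`z, x, x'` such that `x` and `x'` both have joint type `J` with `z` and the symmetrized mean gain in
metric between `x` and `x'` were negative, the joint types of these triples would mix to a law of
`(X, X', Z)` with the exact marginals and negative mean gain. Letting `U` be the pair of inputs and
drawing `X` and `X'` independently and uniformly from `U`, this contradicts the class condition
(`sum_meanGain_nonneg`). Hence some `J` has the property that of any two codewords of joint type `J`
with the same `z`, one has nonnegative mean gain over the other (`exists_jointType`), and for each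
`z` all but at most one codeword of joint type `J` with `z` have a competitor. By the size of `C`
this covers at least half of the pairs `(x, z)` of joint type `J` (`le_sum_card_goodSide`).

*Rounding above the mean.* For such `x, x', z`, the joint type of `(x, x', z)` times `P_{Y|XZ}` is
again a mixture of integral arrays nearby, so that one of them has nonnegative metric gain. All
outputs in the corresponding conditional type class are confused with `x'`
(`exists_confusing_outputs`).

It remains to count. There are about `exp (n H(Z|X))` sequences `z` for each `x` on average, each
gives `exp (n H(Y|X,Z))` outputs, and an output arises from at most `exp (n H(Z|X,Y))` sequences `z`
(`card_isNear_le`). So `x` has about `exp (n H(Y|X))` confusing outputs on average, and by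
`le_chanPow` their probability under `W` is `exp (-n D(P_{Y|X}‖W|P))` up to a polynomial factor. The
errors made in passing from types to the reference distribution are `O(log n)` because the entropy
function changes by `O(log n)` between points of `[0, n]` at bounded distance
(`abs_negMulLog_sub_le`).
-/

noncomputable section

namespace MismatchedDecoding

open Finset Real

/-! ### Joint types and the sizes of conditional type classes -/

open Classical in
/-- The number of positions at which the sequence `s` takes the value `a`. Joint counts of several
sequences are the counts of the sequence of tuples. -/
def count {A : Type*} {n : ℕ} (s : Fin n → A) (a : A) : ℕ :=
  (univ.filter fun i => s i = a).card

/-- The unit `log n + 1` in which all error terms are measured. -/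
def logUnit (n : ℕ) : ℝ := Real.log n + 1

theorem one_le_logUnit (n : ℕ) : 1 ≤ logUnit n := by
  have := Real.log_natCast_nonneg n
  unfold logUnit; linarith

theorem sum_comp_eq_count {A : Type*} [Fintype A] {n : ℕ} (s : Fin n → A) (f : A → ℝ) :
    ∑ i, f (s i) = ∑ a, (count s a : ℝ) * f a := by
  classical
  rw [← Finset.sum_fiberwise univ s]
  refine Finset.sum_congr rfl fun a _ => ?_
  rw [Finset.sum_congr rfl (g := fun _ => f a) fun i hi => by rw [(mem_filter.mp hi).2]]
  rw [Finset.sum_const, nsmul_eq_mul]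
  unfold count; congr!

theorem prod_comp_eq_count {A : Type*} [Fintype A] {n : ℕ} (s : Fin n → A) (f : A → ℝ) :
    ∏ i, f (s i) = ∏ a, f a ^ count s a := by
  classical
  rw [← Finset.prod_fiberwise univ s]
  refine Finset.prod_congr rfl fun a _ => ?_
  rw [Finset.prod_congr rfl (g := fun _ => f a) fun i hi => by rw [(mem_filter.mp hi).2]]
  rw [Finset.prod_const]
  unfold count; congr!

theorem count_le {A : Type*} {n : ℕ} (s : Fin n → A) (a : A) : count s a ≤ n := by
  classical
  unfold count
  exact (card_le_univ _).trans (by simp)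

/-- Counts of a function of a sequence are marginals of the counts of the sequence. -/
theorem count_comp {A B : Type*} [Fintype A] [DecidableEq B] {n : ℕ} (s : Fin n → A) (f : A → B)
    (b : B) : count (fun i => f (s i)) b = ∑ a, if f a = b then count s a else 0 := by
  classical
  have h := sum_comp_eq_count s (fun a => if f a = b then (1 : ℝ) else 0)
  have h1 : (count (fun i => f (s i)) b : ℝ) = ∑ i, if f (s i) = b then (1 : ℝ) else 0 := by
    rw [Finset.sum_boole]; unfold count; congr!
  have : (count (fun i => f (s i)) b : ℝ) =
      ((∑ a, if f a = b then count s a else 0 : ℕ) : ℝ) := by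
    rw [h1, h]; push_cast
    refine Finset.sum_congr rfl fun a _ => ?_
    split_ifs <;> simp
  exact_mod_cast this

theorem sum_count_pair {A B : Type*} [Fintype A] [Fintype B] {n : ℕ} (s : Fin n → A)
    (t : Fin n → B) (a : A) : ∑ b, count (fun i => (s i, t i)) (a, b) = count s a := by
  classical
  have := count_comp (fun i => (s i, t i)) Prod.fst a
  simp only at this
  change _ = count (fun i => s i) a
  rw [this, Fintype.sum_prod_type]
  rw [Finset.sum_comm]
  simp

theorem sum_count {A : Type*} [Fintype A] {n : ℕ} (s : Fin n → A) : ∑ a, count s a = n := by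
  have h := sum_comp_eq_count s (fun _ => (1 : ℝ))
  simp at h
  exact_mod_cast h.symm

open Classical in
/-- The sequences `t` whose joint counts with the given sequence `s` are `K`. -/
def condClass {A B : Type*} [Fintype B] {n : ℕ} (s : Fin n → A) (K : A → B → ℕ) :
    Finset (Fin n → B) :=
  univ.filter fun t => ∀ a b, count (fun i => (s i, t i)) (a, b) = K a b

theorem mem_condClass {A B : Type*} [Fintype B] {n : ℕ} {s : Fin n → A} {K : A → B → ℕ}
    {t : Fin n → B} : t ∈ condClass s K ↔ ∀ a b, count (fun i => (s i, t i)) (a, b) = K a b := by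
  simp [condClass]

/-- A conditional type class is at most as large as the exponential of the empirical conditional
entropy, since its members are equiprobable under the empirical conditional distribution. -/
theorem card_condClass_le {A B : Type*} [Fintype A] [Fintype B] {n : ℕ} (s : Fin n → A)
    (K : A → B → ℕ) :
    ((condClass s K).card : ℝ) ≤
      exp (∑ a, ∑ b, negMulLog (K a b) - ∑ a, negMulLog (count s a)) := by
  classical
  rcases (condClass s K).eq_empty_or_nonempty with h | ⟨t0, ht0⟩
  · rw [h]; simp; positivity
  have hrow : ∀ a, ∑ b, K a b = count s a := fun a => by
    rw [← sum_count_pair s t0 a]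
    exact Finset.sum_congr rfl fun b _ => (mem_condClass.mp ht0 a b).symm
  set p : A → B → ℝ := fun a b => (K a b : ℝ) / (count s a : ℝ) with hp
  have hsum : ∑ t : Fin n → B, ∏ i, p (s i) (t i) = 1 := by
    have := Finset.prod_univ_sum (fun _ : Fin n => (univ : Finset B)) (fun i b => p (s i) b)
    rw [Fintype.piFinset_univ] at this
    rw [← this]
    refine Finset.prod_eq_one fun i _ => ?_
    have hpos : count s (s i) ≠ 0 := by
      unfold count
      exact (Finset.card_pos.mpr ⟨i, by simp⟩).ne'
    simp only [hp]
    rw [← Finset.sum_div, ← Nat.cast_sum, hrow]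
    exact div_self (by exact_mod_cast hpos)
  have hval : ∀ t ∈ condClass s K, ∏ i, p (s i) (t i) =
      exp (-(∑ a, ∑ b, negMulLog (K a b) - ∑ a, negMulLog (count s a))) := by
    intro t ht
    have h1 := prod_comp_eq_count (fun i => (s i, t i)) (fun c : A × B => p c.1 c.2)
    simp only at h1
    rw [h1, Fintype.prod_prod_type]
    have h2 : -(∑ a, ∑ b, negMulLog (K a b) - ∑ a, negMulLog (count s a)) =
        ∑ a, ∑ b, (K a b : ℝ) * (log (K a b) - log (count s a)) := by
      simp only [negMulLog, mul_sub, Finset.sum_sub_distrib]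
      have : ∀ a, ∑ b, (K a b : ℝ) * log (count s a) = count s a * log (count s a) := fun a => by
        rw [← Finset.sum_mul, ← Nat.cast_sum, hrow]
      simp only [this, neg_mul, Finset.sum_neg_distrib]
      ring
    rw [h2, exp_sum]
    refine Finset.prod_congr rfl fun a _ => ?_
    rw [exp_sum]
    refine Finset.prod_congr rfl fun b _ => ?_
    rw [mem_condClass.mp ht a b]
    rcases Nat.eq_zero_or_pos (K a b) with h0 | h0
    · simp [h0]
    · have h0' : (0 : ℝ) < K a b := by exact_mod_cast h0
      have hc : (0 : ℝ) < count s a := by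
        rw [← hrow a]
        exact_mod_cast h0.trans_le (Finset.single_le_sum (f := fun b => K a b)
          (fun _ _ => Nat.zero_le _) (mem_univ b))
      rw [← log_div h0'.ne' hc.ne', mul_comm, exp_mul, exp_log (div_pos h0' hc), rpow_natCast]
  have hle : ∑ t ∈ condClass s K, ∏ i, p (s i) (t i) ≤ 1 := by
    rw [← hsum]
    refine Finset.sum_le_sum_of_subset_of_nonneg (subset_univ _) fun t _ _ => ?_
    exact Finset.prod_nonneg fun i _ => by simp only [hp]; positivity
  rw [Finset.sum_congr rfl hval, Finset.sum_const, nsmul_eq_mul, exp_neg] at hle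
  have := exp_pos (∑ a, ∑ b, negMulLog (K a b) - ∑ a, negMulLog (count s a))
  rwa [← div_eq_mul_inv, div_le_one this] at hle

theorem condClass_nonempty {A B : Type*} [Fintype B] {n : ℕ} (s : Fin n → A)
    (K : A → B → ℕ) (hK : ∀ a, ∑ b, K a b = count s a) : (condClass s K).Nonempty := by
  classical
  have e : ∀ a, Nonempty ({i // s i = a} ≃ (Σ b, Fin (K a b))) := fun a => by
    refine ⟨Fintype.equivOfCardEq ?_⟩
    rw [Fintype.card_sigma]
    simp only [Fintype.card_fin]
    rw [hK, Fintype.card_subtype]; unfold count; congr!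
  replace e := fun a => (e a).some
  refine ⟨fun i => (e (s i) ⟨i, rfl⟩).1, mem_condClass.mpr fun a b => ?_⟩
  have h1 : Fintype.card {x : Σ b, Fin (K a b) // x.1 = b} = K a b := by
    rw [Fintype.card_congr (Equiv.sigmaSubtype b), Fintype.card_fin]
  rw [← h1, ← Fintype.card_congr ((e a).subtypeEquiv (p := fun i => (e a i).1 = b)
    (fun _ => Iff.rfl))]
  unfold count
  rw [← Fintype.card_subtype]
  refine Fintype.card_congr ⟨fun i => ⟨⟨i.1, (Prod.ext_iff.mp i.2).1⟩, ?_⟩,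
    fun i => ⟨i.1.1, ?_⟩, fun _ => rfl, fun _ => rfl⟩
  · have key : ∀ i (h : s i = a), (e (s i) ⟨i, rfl⟩).1 = (e a ⟨i, h⟩).1 := by
      rintro i rfl; rfl
    have h := Prod.ext_iff.mp i.2
    exact (key i.1 h.1).symm.trans h.2
  · obtain ⟨⟨i, rfl⟩, hi⟩ := i
    exact Prod.ext rfl hi

/-- The upper half of Stirling's formula, in terms of `negMulLog`. -/
theorem log_factorial_le {n m : ℕ} (hm : m ≤ n) :
    log (m.factorial : ℝ) ≤ -negMulLog m - m + logUnit n := by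
  rcases Nat.eq_zero_or_pos m with rfl | h0
  · simpa using zero_le_one.trans (one_le_logUnit n)
  obtain ⟨k, rfl⟩ : ∃ k, m = k + 1 := ⟨m - 1, by omega⟩
  have h1 := Stirling.stirlingSeq'_antitone (Nat.zero_le k)
  simp only [Function.comp_apply, Nat.succ_eq_add_one, zero_add] at h1
  have h2 := log_le_log (Stirling.stirlingSeq'_pos k) h1
  rw [Stirling.log_stirlingSeq_formula, Stirling.stirlingSeq_one,
    log_div (exp_pos 1).ne' (by positivity), log_exp, log_sqrt (by norm_num)] at h2
  have hk : (0 : ℝ) < ((k + 1 : ℕ) : ℝ) := by positivity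
  rw [log_mul two_ne_zero hk.ne', log_div hk.ne' (exp_pos 1).ne', log_exp] at h2
  have h3 : log ((k + 1 : ℕ) : ℝ) ≤ log n := log_le_log hk (by exact_mod_cast hm)
  have h4 : 0 ≤ log ((k + 1 : ℕ) : ℝ) := log_natCast_nonneg _
  simp only [negMulLog, logUnit]
  linarith

/-- The lower half of Stirling's formula, in terms of `negMulLog`. -/
theorem le_log_factorial (m : ℕ) : -negMulLog m - m ≤ log (m.factorial : ℝ) := by
  rcases Nat.eq_zero_or_pos m with rfl | h0
  · simp
  have h := Stirling.le_log_factorial_stirling h0.ne'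
  have h4 : 0 ≤ log (m : ℝ) := log_natCast_nonneg _
  have h5 : 0 ≤ log (2 * π) := log_nonneg (by linarith [pi_gt_three])
  simp only [negMulLog]
  linarith

open Classical in
theorem card_perm_fixing {C : Type*} [Fintype C] {n : ℕ} (r : Fin n → C) :
    (univ.filter fun g : Equiv.Perm (Fin n) => r ∘ g = r).card = ∏ c, (count r c).factorial := by
  rw [← Fintype.card_subtype, DomMulAct.stabilizer_card]
  refine Finset.prod_congr rfl fun c _ => ?_
  rw [Fintype.card_subtype]; unfold count; congr!

/-- The permutations which fix `s` act on the sequences with given joint counts with `s`; the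
orbits are large because the stabilizers are products of symmetric groups. -/
theorem prod_factorial_le {A B : Type*} [Fintype A] [Fintype B] {n : ℕ} (s : Fin n → A)
    (K : A → B → ℕ) (hK : ∀ a, ∑ b, K a b = count s a) :
    ∏ a, (count s a).factorial ≤
      (∏ a, ∏ b, (K a b).factorial) * (condClass s K).card := by
  classical
  obtain ⟨t, ht⟩ := condClass_nonempty s K hK
  have key2 : ∏ a, ∏ b, (K a b).factorial =
      (univ.filter fun g : Equiv.Perm (Fin n) =>
        (fun i => (s i, t i)) ∘ g = (fun i => (s i, t i))).card := by
    refine Eq.trans ?_ (Eq.trans (card_perm_fixing fun i => (s i, t i)).symm (by congr!))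
    rw [Fintype.prod_prod_type]
    exact Finset.prod_congr rfl fun a _ => Finset.prod_congr rfl fun b _ => by
      rw [mem_condClass.mp ht a b]
  rw [← card_perm_fixing s, key2]
  refine Finset.card_le_mul_card_image_of_maps_to (f := fun g : Equiv.Perm (Fin n) => t ∘ g)
    (fun g hg => ?_) _ fun u _ => ?_
  · refine mem_condClass.mpr fun a b => ?_
    have hs : s ∘ g = s := (mem_filter.mp hg).2
    rw [← mem_condClass.mp ht a b]
    unfold count
    refine Finset.card_bij (fun i _ => g i) (fun i hi => ?_) (fun i _ j _ h => g.injective h)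
      fun i hi => ⟨g.symm i, ?_, by simp⟩
    · simp only [mem_filter, mem_univ, true_and, Prod.mk.injEq, Function.comp_apply] at hi ⊢
      exact ⟨(congrFun hs i).trans hi.1, hi.2⟩
    · simp only [mem_filter, mem_univ, true_and, Prod.mk.injEq, Function.comp_apply] at hi ⊢
      have := congrFun hs (g.symm i)
      simp only [Function.comp_apply, Equiv.apply_symm_apply] at this ⊢
      exact ⟨this ▸ hi.1, hi.2⟩
  · rcases Finset.eq_empty_or_nonempty
      ((univ.filter fun g : Equiv.Perm (Fin n) => s ∘ g = s).filter
        fun g : Equiv.Perm (Fin n) => t ∘ g = u)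
      with h | ⟨g₀, hg₀⟩
    · rw [h]; simp
    simp only [mem_filter, mem_univ, true_and] at hg₀
    refine Finset.card_le_card_of_injOn (fun g => g * g₀⁻¹) (fun g hg => ?_)
      fun g _ g' _ h => mul_right_cancel h
    simp only [coe_filter, mem_filter, mem_univ, true_and, Set.mem_ofPred_eq] at hg ⊢
    funext i
    have h1 := congrFun (hg.1.trans hg₀.1.symm) (g₀⁻¹ i)
    have h2 := congrFun (hg.2.trans hg₀.2.symm) (g₀⁻¹ i)
    have h0 : g₀ (g₀⁻¹ i) = i := by simp
    simp only [Function.comp_apply, Equiv.Perm.mul_apply, h0] at h1 h2 ⊢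
    rw [h1, h2]

/-- A conditional type class has size at least the exponential of the empirical conditional
entropy, up to a polynomial factor. -/
theorem le_card_condClass {A B : Type*} [Fintype A] [Fintype B] {n : ℕ} (s : Fin n → A)
    (K : A → B → ℕ) (hK : ∀ a, ∑ b, K a b = count s a) :
    exp (∑ a, ∑ b, negMulLog (K a b) - ∑ a, negMulLog (count s a)
      - Fintype.card A * Fintype.card B * logUnit n) ≤ ((condClass s K).card : ℝ) := by
  classical
  have hle : ∀ a b, K a b ≤ n := fun a b =>
    (Finset.single_le_sum (f := fun b => K a b) (fun _ _ => Nat.zero_le _) (mem_univ b)).trans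
      ((hK a).le.trans (count_le s a))
  have hpos : (0 : ℝ) < (condClass s K).card := by
    exact_mod_cast Finset.card_pos.mpr (condClass_nonempty s K hK)
  rw [← le_log_iff_exp_le hpos]
  have h : (∏ a, ((count s a).factorial : ℝ)) ≤
      (∏ a, ∏ b, ((K a b).factorial : ℝ)) * (condClass s K).card := by
    exact_mod_cast prod_factorial_le s K hK
  have hne : ∀ m : ℕ, (m.factorial : ℝ) ≠ 0 := fun m => by exact_mod_cast m.factorial_ne_zero
  have h' := log_le_log (Finset.prod_pos fun a _ => by positivity) h
  rw [log_mul (Finset.prod_ne_zero_iff.mpr fun a _ => Finset.prod_ne_zero_iff.mpr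
    fun b _ => hne _) hpos.ne', log_prod fun a _ => hne _,
    log_prod fun a _ => Finset.prod_ne_zero_iff.mpr fun b _ => hne _] at h'
  have h1 : ∑ a, (-negMulLog (count s a) - count s a) ≤ ∑ a, log ((count s a).factorial : ℝ) :=
    Finset.sum_le_sum fun a _ => le_log_factorial _
  have h2 : ∑ a, log (∏ b, ((K a b).factorial : ℝ)) ≤
      ∑ a, ∑ b, (-negMulLog (K a b) - K a b + logUnit n) :=
    Finset.sum_le_sum fun a _ => by
      rw [log_prod fun b _ => hne _]
      exact Finset.sum_le_sum fun b _ => log_factorial_le (hle a b)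
  have h3 : ∀ a, ∑ b, (K a b : ℝ) = count s a := fun a => by exact_mod_cast hK a
  simp only [Finset.sum_add_distrib, Finset.sum_sub_distrib, Finset.sum_neg_distrib, h3,
    Finset.sum_const, Finset.card_univ, nsmul_eq_mul] at h1 h2
  linarith

/-! ### Continuity of the entropy function at the scale of one count -/

theorem negMulLog_sub_le {n : ℕ} {a b c : ℝ} (hn : 0 < n) (ha : 0 ≤ a) (hb : b ≤ n)
    (hab : a ≤ b) (hc : b - a ≤ c) :
    |negMulLog a - negMulLog b| ≤ (c + 1) * logUnit n := by
  have hL := one_le_logUnit n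
  have hc0 : 0 ≤ c := (sub_nonneg.mpr hab).trans hc
  have hn' : (1 : ℝ) ≤ n := by exact_mod_cast hn
  rcases ha.eq_or_lt with rfl | ha'
  · rw [negMulLog_zero, zero_sub, abs_neg]
    rcases hab.eq_or_lt with rfl | hb0
    · simp; positivity
    have h1 : negMulLog b ≤ 1 := (negMulLog_le_one_sub_self hb0.le).trans (by linarith)
    have h2 : -negMulLog b ≤ c * logUnit n := by
      have : log b ≤ logUnit n := by
        have := log_le_log hb0 hb
        unfold logUnit; linarith
      simp only [negMulLog, neg_mul, neg_neg]
      nlinarith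
    rw [abs_le]
    constructor <;> nlinarith
  have hb0 : 0 < b := ha'.trans_le hab
  have hlog : log b ≤ log n := log_le_log hb0 hb
  rw [abs_le]
  constructor
  · -- superadditivity of `t log t`, and `t log t ≥ -1`
    rcases hab.eq_or_lt with rfl | hlt
    · simp; positivity
    have h1 : negMulLog (b - a) ≤ 1 :=
      (negMulLog_le_one_sub_self (sub_pos.mpr hlt).le).trans (by linarith)
    have h2 : log a ≤ log b := log_le_log ha' hab
    have h3 : log (b - a) ≤ log b := log_le_log (sub_pos.mpr hlt) (by linarith)
    simp only [negMulLog] at h1 ⊢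
    have h4 : a * log a ≤ a * log b := mul_le_mul_of_nonneg_left h2 ha
    have h5 : (b - a) * log (b - a) ≤ (b - a) * log b :=
      mul_le_mul_of_nonneg_left h3 (sub_pos.mpr hlt).le
    nlinarith
  · -- the mean value bound with derivative `log b + 1`
    have h1 : a * (log b - log a) ≤ b - a := by
      rw [← log_div hb0.ne' ha'.ne']
      have := mul_le_mul_of_nonneg_left (log_le_sub_one_of_pos (div_pos hb0 ha')) ha
      have e : a * (b / a - 1) = b - a := by field_simp
      linarith
    have h2 : (b - a) * (log b + 1) ≤ c * logUnit n := by
      calc (b - a) * (log b + 1) ≤ (b - a) * logUnit n :=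
            mul_le_mul_of_nonneg_left (by unfold logUnit; linarith) (by linarith)
        _ ≤ c * logUnit n := mul_le_mul_of_nonneg_right hc (by linarith)
    simp only [negMulLog]
    nlinarith

/-- On `[0, n]` the entropy function changes by `O(log n)` when its argument changes by `O(1)`. -/
theorem abs_negMulLog_sub_le {n : ℕ} {a b c : ℝ} (hn : 0 < n) (ha : 0 ≤ a) (hb : 0 ≤ b)
    (han : a ≤ n) (hbn : b ≤ n) (hc : |a - b| ≤ c) :
    |negMulLog a - negMulLog b| ≤ (c + 1) * logUnit n := by
  rcases le_total a b with h | h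
  · exact negMulLog_sub_le hn ha hbn h (by rw [abs_sub_comm] at hc; exact (le_abs_self _).trans hc)
  · rw [abs_sub_comm]
    exact negMulLog_sub_le hn hb han h ((le_abs_self _).trans hc)

/-! ### Integral rounding of arrays with integral row sums -/

/-- The integral arrays with the row sums of `v` whose entries lie between the floors and the
ceilings of the entries of `v`. -/
def roundings {G B : Type*} [Fintype B] (v : G → B → ℝ) : Set (G → B → ℝ) :=
  {w | (∀ g b, ∃ k : ℤ, w g b = k) ∧ (∀ g b, (⌊v g b⌋ : ℝ) ≤ w g b ∧ w g b ≤ ⌈v g b⌉) ∧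
    ∀ g, ∑ b, w g b = ∑ b, v g b}

theorem roundings_subset {G B : Type*} [Fintype B] {v v' : G → B → ℝ}
    (h : ∀ g b, (⌊v g b⌋ : ℝ) ≤ v' g b ∧ v' g b ≤ ⌈v g b⌉)
    (hs : ∀ g, ∑ b, v' g b = ∑ b, v g b) : roundings v' ⊆ roundings v := by
  rintro w ⟨h1, h2, h3⟩
  refine ⟨h1, fun g b => ⟨?_, ?_⟩, fun g => (h3 g).trans (hs g)⟩
  · exact le_trans (by exact_mod_cast Int.le_floor.mpr (h g b).1) (h2 g b).1
  · exact (h2 g b).2.trans (by exact_mod_cast Int.ceil_le.mpr (h g b).2)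

open Classical in
/-- The positions of the fractional entries of an array. -/
def fracPositions {G B : Type*} [Fintype G] [Fintype B] (v : G → B → ℝ) : Finset (G × B) :=
  univ.filter fun c => ¬ ∃ k : ℤ, v c.1 c.2 = k

/-- Mass can be moved between two fractional entries of a row until one of them is integral. -/
theorem exists_shift {G B : Type*} [Fintype G] [Fintype B] [DecidableEq G] [DecidableEq B]
    (v : G → B → ℝ) {g : G} {b₁ b₂ : B} (hb : b₁ ≠ b₂) (h₁ : ¬ ∃ k : ℤ, v g b₁ = k)
    (h₂ : ¬ ∃ k : ℤ, v g b₂ = k) :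
    ∃ t : ℝ, 0 < t ∧ ∃ v' : G → B → ℝ,
      (v' = v + t • (Pi.single g (Pi.single b₁ 1) - Pi.single g (Pi.single b₂ 1))) ∧
      (fracPositions v').card < (fracPositions v).card ∧ roundings v' ⊆ roundings v ∧
      ∀ g, ∑ b, v' g b = ∑ b, v g b := by
  have c₁ : v g b₁ < ⌈v g b₁⌉ := (Int.le_ceil _).lt_of_ne fun h => h₁ ⟨_, h⟩
  have c₂ : (⌊v g b₂⌋ : ℝ) < v g b₂ := (Int.floor_le _).lt_of_ne fun h => h₂ ⟨_, h.symm⟩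
  set t := min (⌈v g b₁⌉ - v g b₁) (v g b₂ - ⌊v g b₂⌋) with ht
  have ht0 : 0 < t := lt_min (by linarith) (by linarith)
  refine ⟨t, ht0, _, rfl, ?_⟩
  set v' := v + t • (Pi.single g (Pi.single b₁ 1) - Pi.single g (Pi.single b₂ 1) : G → B → ℝ)
    with hv'
  have e₁ : v' g b₁ = v g b₁ + t := by simp [hv', hb]
  have e₂ : v' g b₂ = v g b₂ - t := by simp [hv', hb.symm, sub_eq_add_neg]
  have e₃ : ∀ g' b, (g', b) ≠ (g, b₁) → (g', b) ≠ (g, b₂) → v' g' b = v g' b := by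
    intro g' b n1 n2
    rcases eq_or_ne g' g with rfl | hg
    · have n1' : b ≠ b₁ := fun h => n1 (by rw [h])
      have n2' : b ≠ b₂ := fun h => n2 (by rw [h])
      simp [hv', n1', n2']
    · simp [hv', hg]
  have hbd : ∀ g' b, (⌊v g' b⌋ : ℝ) ≤ v' g' b ∧ v' g' b ≤ ⌈v g' b⌉ := by
    intro g' b
    by_cases n1 : (g', b) = (g, b₁)
    · obtain ⟨rfl, rfl⟩ := Prod.ext_iff.mp n1
      simp only at e₁ ⊢
      have := min_le_left (⌈v g' b⌉ - v g' b) (v g' b₂ - ⌊v g' b₂⌋)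
      have := Int.floor_le (v g' b)
      rw [e₁]; constructor <;> linarith
    by_cases n2 : (g', b) = (g, b₂)
    · obtain ⟨rfl, rfl⟩ := Prod.ext_iff.mp n2
      simp only at e₂ ⊢
      have := min_le_right (⌈v g' b₁⌉ - v g' b₁) (v g' b - ⌊v g' b⌋)
      have := Int.le_ceil (v g' b)
      rw [e₂]; constructor <;> linarith
    rw [e₃ g' b n1 n2]
    exact ⟨Int.floor_le _, Int.le_ceil _⟩
  have hsum : ∀ g', ∑ b, v' g' b = ∑ b, v g' b := by
    intro g'
    simp only [hv', Pi.add_apply, Pi.smul_apply, Pi.sub_apply, smul_eq_mul,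
      Finset.sum_add_distrib, ← Finset.mul_sum, Finset.sum_sub_distrib]
    rcases eq_or_ne g' g with rfl | hg
    · simp
    · simp [hg]
  refine ⟨Finset.card_lt_card ?_, roundings_subset hbd hsum, hsum⟩
  have hsub : fracPositions v' ⊆ fracPositions v := by
    intro c hc
    simp only [fracPositions, mem_filter, mem_univ, true_and] at hc ⊢
    rintro ⟨k, hk⟩
    have := hbd c.1 c.2
    rw [hk, Int.floor_intCast, Int.ceil_intCast] at this
    exact hc ⟨k, le_antisymm this.2 this.1⟩
  refine (Finset.ssubset_iff_of_subset hsub).mpr ?_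
  rcases min_choice (⌈v g b₁⌉ - v g b₁) (v g b₂ - ⌊v g b₂⌋) with h | h
  · refine ⟨(g, b₁), by simp [fracPositions, h₁], ?_⟩
    simp only [fracPositions, mem_filter, mem_univ, true_and, not_not]
    exact ⟨⌈v g b₁⌉, by rw [e₁, ht, h]; ring⟩
  · refine ⟨(g, b₂), by simp [fracPositions, h₂], ?_⟩
    simp only [fracPositions, mem_filter, mem_univ, true_and, not_not]
    exact ⟨⌊v g b₂⌋, by rw [e₂, ht, h]; ring⟩

/-- An array with integral row sums is a mixture of its roundings. -/
theorem mem_convexHull_roundings {G B : Type*} [Fintype G] [Fintype B] (v : G → B → ℝ)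
    (hv : ∀ g, ∃ m : ℤ, ∑ b, v g b = m) : v ∈ convexHull ℝ (roundings v) := by
  classical
  induction hN : (fracPositions v).card using Nat.strong_induction_on generalizing v with
  | _ N ih =>
    subst hN
    by_cases hint : ∀ g b, ∃ k : ℤ, v g b = k
    · exact subset_convexHull ℝ _ ⟨hint, fun g b => ⟨Int.floor_le _, Int.le_ceil _⟩, fun _ => rfl⟩
    push Not at hint
    obtain ⟨g, b₁, h₁⟩ := hint
    have h₁' : ¬ ∃ k : ℤ, v g b₁ = k := by simpa using h₁
    obtain ⟨b₂, hb, h₂⟩ : ∃ b₂, b₁ ≠ b₂ ∧ ¬ ∃ k : ℤ, v g b₂ = k := by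
      by_contra! hcon
      choose! k hk using hcon
      obtain ⟨m, hm⟩ := hv g
      refine h₁' ⟨m - ∑ b ∈ univ.erase b₁, k b, ?_⟩
      rw [← Finset.add_sum_erase _ _ (mem_univ b₁), Finset.sum_congr rfl
        (g := fun b => (k b : ℝ)) fun b hb => hk b (Finset.ne_of_mem_erase hb).symm] at hm
      push_cast
      linarith
    obtain ⟨t, ht, v', e, hcard, hsub, hs⟩ := exists_shift v hb h₁' h₂
    obtain ⟨t', ht', v'', e', hcard', hsub', hs'⟩ := exists_shift v hb.symm h₂ h₁'
    have m1 := convexHull_mono (𝕜 := ℝ) hsub (ih _ hcard v' (fun g => by rw [hs]; exact hv g) rfl)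
    have m2 := convexHull_mono (𝕜 := ℝ) hsub'
      (ih _ hcard' v'' (fun g => by rw [hs']; exact hv g) rfl)
    have key := convex_convexHull ℝ (roundings v) m1 m2 (a := t' / (t + t')) (b := t / (t + t'))
      (by positivity) (by positivity) (by field_simp; ring)
    convert key using 1
    rw [e, e']
    funext g' b
    simp only [Pi.add_apply, Pi.smul_apply, Pi.sub_apply, smul_eq_mul]
    field_simp
    ring

/-- The roundings of a nonnegative array are arrays of natural numbers which vanish where the
array vanishes. -/
theorem exists_nat_of_mem_roundings {G B : Type*} [Fintype B] {v w : G → B → ℝ}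
    (hv : ∀ g b, 0 ≤ v g b) (hw : w ∈ roundings v) :
    ∃ k : G → B → ℕ, (∀ g b, w g b = k g b) ∧ (∀ g b, |(k g b : ℝ) - v g b| ≤ 1) ∧
      (∀ g b, v g b = 0 → k g b = 0) ∧ ∀ g, ∑ b, (k g b : ℝ) = ∑ b, v g b := by
  obtain ⟨h1, h2, h3⟩ := hw
  choose k hk using h1
  have hk0 : ∀ g b, 0 ≤ k g b := fun g b => by
    have := (h2 g b).1
    rw [hk] at this
    exact (Int.floor_nonneg.mpr (hv g b)).trans (by exact_mod_cast this)
  have hc : ∀ g b, ((k g b).toNat : ℝ) = w g b := fun g b => by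
    rw [hk]; exact_mod_cast Int.toNat_of_nonneg (hk0 g b)
  refine ⟨fun g b => (k g b).toNat, fun g b => (hc g b).symm, fun g b => ?_, fun g b h0 => ?_,
    fun g => ?_⟩
  · rw [hc, abs_le]
    have := h2 g b
    have := Int.lt_floor_add_one (v g b)
    have := Int.ceil_lt_add_one (v g b)
    constructor <;> linarith
  · have h := h2 g b
    rw [h0, Int.floor_zero, Int.ceil_zero, ← hc] at h
    exact_mod_cast le_antisymm h.2 h.1
  · simp only [hc]; exact h3 g

/-! ### Pairs of inputs in a two-output channel of the class -/

/-- The conditional probability `P_{Y|XZ}(y|x,z)` of a two-output channel (`0` if `z` is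
impossible given `x`). -/
def backKernel {X Y Z : Type*} [Fintype Y] (Q : X → Y × Z → ℝ) (x : X) (z : Z) (y : Y) : ℝ :=
  Q x (y, z) / margZ Q x z

/-- The expected gain in metric from replacing the symbol `a` by the symbol `b`, when `Y` is
generated from `a` and `z`. -/
def meanGain {X Y Z : Type*} [Fintype Y] (q : X → Y → ℝ) (Q : X → Y × Z → ℝ) (a b : X) (z : Z) :
    ℝ :=
  ∑ y, backKernel Q a z y * (q b y - q a y)

theorem sum_backKernel {X Y Z : Type*} [Fintype Y] {Q : X → Y × Z → ℝ} {x : X} {z : Z}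
    (h : margZ Q x z ≠ 0) : ∑ y, backKernel Q x z y = 1 := by
  unfold backKernel
  rw [← Finset.sum_div]
  exact div_self h

section Kernel

variable {X Y Z : Type*} [Fintype Y] [Fintype Z] {Q : X → Y × Z → ℝ}

theorem margZ_nonneg (hQ : IsChannel Q) (x : X) (z : Z) : 0 ≤ margZ Q x z :=
  Finset.sum_nonneg fun y _ => (hQ x).1 (y, z)

theorem sum_margZ (hQ : IsChannel Q) (x : X) : ∑ z, margZ Q x z = 1 := by
  rw [← (hQ x).2, Fintype.sum_prod_type_right]
  rfl

theorem backKernel_nonneg (hQ : IsChannel Q) (x : X) (z : Z) (y : Y) : 0 ≤ backKernel Q x z y :=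
  div_nonneg ((hQ x).1 _) (margZ_nonneg hQ x z)

theorem backKernel_mul_margZ (hQ : IsChannel Q) (x : X) (z : Z) (y : Y) :
    backKernel Q x z y * margZ Q x z = Q x (y, z) := by
  rcases eq_or_ne (margZ Q x z) 0 with h | h
  · have := (Finset.sum_eq_zero_iff_of_nonneg fun y _ => (hQ x).1 (y, z)).mp h y (mem_univ y)
    rw [h, this, mul_zero]
  · exact div_mul_cancel₀ _ h

theorem backKernel_le_one (hQ : IsChannel Q) (x : X) (z : Z) (y : Y) :
    backKernel Q x z y ≤ 1 :=
  div_le_one_of_le₀ (Finset.single_le_sum (f := fun y => Q x (y, z))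
    (fun y _ => (hQ x).1 (y, z)) (mem_univ y)) (margZ_nonneg hQ x z)

end Kernel

section Pairs

variable {U X Y Z : Type*} [Fintype U] [Fintype X] [Fintype Y]

open Classical in
/-- Twice the probability of `x` under the uniform law on the pair `p`. -/
def pairWeight {X : Type*} (p : X × X) (x : X) : ℝ :=
  (if x = p.1 then 1 else 0) + if x = p.2 then 1 else 0

theorem sum_pairWeight_mul {X : Type*} [Fintype X] (p : X × X) (f : X → ℝ) :
    ∑ x, pairWeight p x * f x = f p.1 + f p.2 := by
  classical
  simp [pairWeight, add_mul, Finset.sum_add_distrib]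

theorem sum_pairWeight {X : Type*} [Fintype X] (p : X × X) : ∑ x, pairWeight p x = 2 := by
  have := sum_pairWeight_mul p (fun _ => (1 : ℝ))
  simp only [mul_one] at this
  rw [this]; norm_num

theorem pairWeight_nonneg {X : Type*} (p : X × X) (x : X) : 0 ≤ pairWeight p x := by
  classical
  unfold pairWeight; positivity

/-- The law of `(U, X', X, Z, Y)` in which `(U, Z)` has law `μ`, where `U` is a pair of inputs,
`X` and `X'` are independent and uniform on this pair, and `Y` is generated from `(X, Z)`. -/
def pairLaw (Q : X → Y × Z → ℝ) (μ : X × X → Z → ℝ) (e : U ≃ X × X) :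
    U × X × X × Z × Y → ℝ := fun v =>
  μ (e v.1) v.2.2.2.1 / 4 * pairWeight (e v.1) v.2.1 * pairWeight (e v.1) v.2.2.1 *
    backKernel Q v.2.2.1 v.2.2.2.1 v.2.2.2.2

variable {P : X → ℝ} {Q : X → Y × Z → ℝ} {μ : X × X → Z → ℝ}

theorem sum_pairWeight_mul_left (h₁ : ∀ x z, ∑ b, μ (x, b) z = P x * margZ Q x z)
    (h₂ : ∀ x z, ∑ a, μ (a, x) z = P x * margZ Q x z) (e : U ≃ X × X) (x : X) (z : Z) :
    ∑ u, μ (e u) z * pairWeight (e u) x = 2 * (P x * margZ Q x z) := by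
  classical
  rw [Equiv.sum_comp e fun p => μ p z * pairWeight p x, Fintype.sum_prod_type]
  simp only [pairWeight, mul_add, Finset.sum_add_distrib]
  have e1 : ∑ a, ∑ b, μ (a, b) z * (if x = a then 1 else 0) = P x * margZ Q x z := by
    rw [← h₁ x z, Finset.sum_comm]
    simp
  have e2 : ∑ a, ∑ b, μ (a, b) z * (if x = b then 1 else 0) = P x * margZ Q x z := by
    rw [← h₂ x z]
    simp
  rw [e1, e2]; ring

theorem sum_pairLaw (hμ : ∀ p z, 0 ≤ μ p z)
    (h₁ : ∀ x z, ∑ b, μ (x, b) z = P x * margZ Q x z)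
    (h₂ : ∀ x z, ∑ a, μ (a, x) z = P x * margZ Q x z) (e : U ≃ X × X) (u : U) (x' x : X)
    (z : Z) : ∑ y, pairLaw Q μ e (u, x', x, z, y) =
      μ (e u) z / 4 * pairWeight (e u) x' * pairWeight (e u) x := by
  simp only [pairLaw]
  rw [← Finset.mul_sum]
  by_cases hm : margZ Q x z = 0
  · have h3 := sum_pairWeight_mul_left h₁ h₂ e x z
    rw [hm, mul_zero, mul_zero] at h3
    have h4 := (Finset.sum_eq_zero_iff_of_nonneg fun u _ =>
      mul_nonneg (hμ (e u) z) (pairWeight_nonneg (e u) x)).mp h3 u (mem_univ u)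
    have h5 : μ (e u) z / 4 * pairWeight (e u) x' * pairWeight (e u) x = 0 := by
      linear_combination pairWeight (e u) x' / 4 * h4
    rw [h5, zero_mul]
  · rw [sum_backKernel hm, mul_one]

variable [Fintype Z]

theorem admissible_pairLaw (hP : ∑ x, P x = 1) (hQ : IsChannel Q) (hμ : ∀ p z, 0 ≤ μ p z)
    (h₁ : ∀ x z, ∑ b, μ (x, b) z = P x * margZ Q x z)
    (h₂ : ∀ x z, ∑ a, μ (a, x) z = P x * margZ Q x z) (e : U ≃ X × X) :
    Admissible P Q (pairLaw Q μ e) := by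
  have hY := sum_pairLaw hμ h₁ h₂ e
  have hmarg : ∀ x z y, ∑ u, ∑ x', pairLaw Q μ e (u, x', x, z, y) = P x * Q x (y, z) := by
    intro x z y
    have e1 : ∀ u, ∑ x', pairLaw Q μ e (u, x', x, z, y) =
        backKernel Q x z y / 2 * (μ (e u) z * pairWeight (e u) x) := fun u => by
      simp only [pairLaw, ← Finset.sum_mul, ← Finset.mul_sum, sum_pairWeight]
      ring
    simp only [e1, ← Finset.mul_sum]
    rw [sum_pairWeight_mul_left h₁ h₂ e, ← backKernel_mul_margZ hQ x z y]
    ring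
  refine ⟨⟨fun v => ?_, ?_⟩, hmarg, fun u x' x z => ?_, fun u x' x z => ?_,
    fun u x' x z y => ?_⟩
  · exact mul_nonneg (mul_nonneg (mul_nonneg (div_nonneg (hμ _ _) (by norm_num))
      (pairWeight_nonneg _ _)) (pairWeight_nonneg _ _)) (backKernel_nonneg hQ _ _ _)
  · have e1 : ∑ v : U × X × X × Z × Y, pairLaw Q μ e v =
        ∑ x, ∑ z, ∑ y, ∑ u, ∑ x', pairLaw Q μ e (u, x', x, z, y) := by
      simp only [Fintype.sum_prod_type]
      calc ∑ u, ∑ x', ∑ x, ∑ z, ∑ y, pairLaw Q μ e (u, x', x, z, y)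
          = ∑ u, ∑ x, ∑ z, ∑ y, ∑ x', pairLaw Q μ e (u, x', x, z, y) := by
            refine Finset.sum_congr rfl fun u _ => ?_
            rw [Finset.sum_comm]
            refine Finset.sum_congr rfl fun x _ => ?_
            rw [Finset.sum_comm]
            exact Finset.sum_congr rfl fun z _ => Finset.sum_comm
        _ = _ := by
            rw [Finset.sum_comm]
            refine Finset.sum_congr rfl fun x _ => ?_
            rw [Finset.sum_comm]
            refine Finset.sum_congr rfl fun z _ => ?_
            rw [Finset.sum_comm]
    rw [e1]
    simp only [hmarg, ← Finset.mul_sum]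
    rw [← hP]
    refine Finset.sum_congr rfl fun x _ => ?_
    have := sum_margZ hQ x
    simp only [margZ] at this
    rw [this, mul_one]
  · rw [hY, hY]; ring
  · simp only [hY, ← Finset.sum_mul, ← Finset.mul_sum, sum_pairWeight]
    ring
  · have e1 : ∑ u', ∑ a, ∑ y', pairLaw Q μ e (u', a, x, z, y') = P x * margZ Q x z := by
      have e2 : ∀ u', ∑ a, ∑ y', pairLaw Q μ e (u', a, x, z, y') =
          1 / 2 * (μ (e u') z * pairWeight (e u') x) := fun u' => by
        simp only [hY, ← Finset.sum_mul, ← Finset.mul_sum, sum_pairWeight]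
        ring
      simp only [e2, ← Finset.mul_sum]
      rw [sum_pairWeight_mul_left h₁ h₂ e]; ring
    rw [e1, hmarg, hY, ← backKernel_mul_margZ hQ x z y]
    simp only [pairLaw]
    ring

/-- In a two-output channel of the class, the symmetrized mean gain is nonnegative on average for
every law of `(X, X', Z)` whose two marginals on an input and `Z` are those of the channel. -/
theorem sum_meanGain_nonneg [Nonempty Z] {q : X → Y → ℝ} (hP : ∑ x, P x = 1)
    (hQ : Q ∈ twoOutputClass q P) (hμ : ∀ p z, 0 ≤ μ p z)
    (h₁ : ∀ x z, ∑ b, μ (x, b) z = P x * margZ Q x z)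
    (h₂ : ∀ x z, ∑ a, μ (a, x) z = P x * margZ Q x z) :
    0 ≤ ∑ p, ∑ z, μ p z * (meanGain q Q p.1 p.2 z + meanGain q Q p.2 p.1 z) := by
  set e : Fin (Fintype.card (X × X)) ≃ X × X := (Fintype.equivFin (X × X)).symm
  have hk : Fintype.card (X × X) ≤ Fintype.card X ^ 2 * Fintype.card Z := by
    rw [Fintype.card_prod, ← sq]
    exact Nat.le_mul_of_pos_right _ Fintype.card_pos
  have h := hQ.2 _ hk (pairLaw Q μ e) (admissible_pairLaw hP hQ.1 hμ h₁ h₂ e)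
  rw [← sub_nonneg] at h
  simp only [← Finset.sum_sub_distrib, ← mul_sub] at h
  have key : ∀ u, ∑ x', ∑ x, ∑ z, ∑ y, pairLaw Q μ e (u, x', x, z, y) * (q x' y - q x y) =
      ∑ z, μ (e u) z / 4 *
        (meanGain q Q (e u).1 (e u).2 z + meanGain q Q (e u).2 (e u).1 z) := by
    intro u
    have e1 : ∀ x' x z, ∑ y, pairLaw Q μ e (u, x', x, z, y) * (q x' y - q x y) =
        μ (e u) z / 4 * (pairWeight (e u) x' * (pairWeight (e u) x * meanGain q Q x x' z)) := by
      intro x' x z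
      simp only [meanGain, pairLaw, Finset.mul_sum]
      exact Finset.sum_congr rfl fun y _ => by ring
    simp only [e1]
    have e2 : ∀ x', ∑ x, ∑ z,
        μ (e u) z / 4 * (pairWeight (e u) x' * (pairWeight (e u) x * meanGain q Q x x' z)) =
        pairWeight (e u) x' * ∑ z, μ (e u) z / 4 *
          (meanGain q Q (e u).1 x' z + meanGain q Q (e u).2 x' z) := by
      intro x'
      rw [Finset.sum_comm, Finset.mul_sum]
      refine Finset.sum_congr rfl fun z _ => ?_
      rw [← sum_pairWeight_mul (e u) (fun x => meanGain q Q x x' z)]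
      simp only [Finset.mul_sum]
      exact Finset.sum_congr rfl fun y _ => by ring
    simp only [e2]
    rw [sum_pairWeight_mul, ← Finset.sum_add_distrib]
    refine Finset.sum_congr rfl fun z _ => ?_
    have e3 : ∀ a, meanGain q Q a a z = 0 := fun a => by simp [meanGain]
    rw [e3, e3]; ring
  simp only [key] at h
  rw [Equiv.sum_comp e fun p => ∑ z, μ p z / 4 *
    (meanGain q Q p.1 p.2 z + meanGain q Q p.2 p.1 z)] at h
  have e4 : ∑ p, ∑ z, μ p z * (meanGain q Q p.1 p.2 z + meanGain q Q p.2 p.1 z) =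
      4 * ∑ p, ∑ z, μ p z / 4 * (meanGain q Q p.1 p.2 z + meanGain q Q p.2 p.1 z) := by
    simp only [Finset.mul_sum]
    exact Finset.sum_congr rfl fun p _ => Finset.sum_congr rfl fun z _ => by ring
  rw [e4]
  positivity

end Pairs

/-! ### A joint type for which pairs of codewords have nonnegative symmetrized gain -/

/-- The class condition passes from the channel to a joint type `J` near `n P × P_{Z|X}`: whenever
`x` and `x'` both have joint type `J` with `z`, the symmetrized mean gain between them is
nonnegative. Otherwise every rounding of `n P × P_{Z|X}` would carry a violating pair; the joint
types of these pairs would mix to a law with the exact marginals and negative mean gain. -/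
theorem exists_jointType {X Y Z : Type*} [Fintype X] [Fintype Y] [Fintype Z] [Nonempty Z] {n : ℕ}
    (hn : 0 < n) {q : X → Y → ℝ} {P : X → ℝ} {Q : X → Y × Z → ℝ} {N : X → ℕ}
    (hN : ∀ a, (N a : ℝ) = n * P a) (hsum : ∑ a, P a = 1) (hQ : Q ∈ twoOutputClass q P) :
    ∃ J : X → Z → ℕ, (∀ a, ∑ ζ, J a ζ = N a) ∧
      (∀ a ζ, |(J a ζ : ℝ) - n * (P a * margZ Q a ζ)| ≤ 1) ∧
      (∀ a ζ, n * (P a * margZ Q a ζ) = 0 → J a ζ = 0) ∧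
      ∀ (x x' : Fin n → X) (z : Fin n → Z), z ∈ condClass x J → z ∈ condClass x' J →
        0 ≤ ∑ i, (meanGain q Q (x i) (x' i) (z i) + meanGain q Q (x' i) (x i) (z i)) := by
  classical
  have hn' : (0 : ℝ) < n := by exact_mod_cast hn
  have hP0 : ∀ a, 0 ≤ P a := fun a => by
    have : 0 ≤ (n : ℝ) * P a := hN a ▸ Nat.cast_nonneg _
    exact nonneg_of_mul_nonneg_right this hn'
  set v : X → Z → ℝ := fun a ζ => n * (P a * margZ Q a ζ) with hv
  have hv0 : ∀ a ζ, 0 ≤ v a ζ := fun a ζ =>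
    mul_nonneg hn'.le (mul_nonneg (hP0 a) (margZ_nonneg hQ.1 a ζ))
  have hvs : ∀ a, ∑ ζ, v a ζ = N a := fun a => by
    simp only [hv, ← Finset.mul_sum, sum_margZ hQ.1, mul_one, hN]
  have hmem := mem_convexHull_roundings v fun a => ⟨N a, by rw [hvs]; simp⟩
  set T : Set (X → Z → ℝ) := {w | ∃ μ : X × X → Z → ℝ, (∀ p z, 0 ≤ μ p z) ∧
    (∀ x z, ∑ b, μ (x, b) z = w x z) ∧ (∀ x z, ∑ a, μ (a, x) z = w x z) ∧
    ∑ p, ∑ z, μ p z * (meanGain q Q p.1 p.2 z + meanGain q Q p.2 p.1 z) < 0} with hT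
  have hTconv : Convex ℝ T := by
    rintro w ⟨μ, m0, m1, m2, m3⟩ w' ⟨μ', m0', m1', m2', m3'⟩ s t hs ht hst
    refine ⟨s • μ + t • μ', fun p z => ?_, fun x z => ?_, fun x z => ?_, ?_⟩
    · have := m0 p z
      have := m0' p z
      simp only [Pi.add_apply, Pi.smul_apply, smul_eq_mul]; positivity
    · simp only [Pi.add_apply, Pi.smul_apply, smul_eq_mul, Finset.sum_add_distrib,
        ← Finset.mul_sum, m1, m1']
    · simp only [Pi.add_apply, Pi.smul_apply, smul_eq_mul, Finset.sum_add_distrib,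
        ← Finset.mul_sum, m2, m2']
    · simp only [Pi.add_apply, Pi.smul_apply, smul_eq_mul, add_mul, Finset.sum_add_distrib,
        mul_assoc, ← Finset.mul_sum]
      rcases hs.eq_or_lt with rfl | hs'
      · rw [zero_add] at hst
        rw [hst]; simpa using m3'
      · nlinarith
  by_contra hcon
  push Not at hcon
  have hsub : roundings v ⊆ T := by
    intro w hw
    obtain ⟨J, j1, j2, j3, j4⟩ := exists_nat_of_mem_roundings hv0 hw
    obtain ⟨x, x', z, hx, hx', hneg⟩ := hcon J
      (fun a => by exact_mod_cast (j4 a).trans (hvs a)) j2 j3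
    refine ⟨fun p ζ => count (fun i => ((x i, x' i), z i)) (p, ζ), fun p ζ => Nat.cast_nonneg _,
      fun a ζ => ?_, fun a ζ => ?_, ?_⟩
    · rw [j1, ← mem_condClass.mp hx a ζ,
        count_comp (fun i => ((x i, x' i), z i)) (fun c => (c.1.1, c.2)) (a, ζ)]
      rw [← Nat.cast_sum]
      congr 1
      simp only [Fintype.sum_prod_type, Prod.mk.injEq, ite_and]
      rw [Finset.sum_comm]
      simp
    · rw [j1, ← mem_condClass.mp hx' a ζ,
        count_comp (fun i => ((x i, x' i), z i)) (fun c => (c.1.2, c.2)) (a, ζ)]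
      rw [← Nat.cast_sum]
      congr 1
      simp only [Fintype.sum_prod_type, Prod.mk.injEq, ite_and]
      simp
    · have := sum_comp_eq_count (fun i => ((x i, x' i), z i))
        (fun c => meanGain q Q c.1.1 c.1.2 c.2 + meanGain q Q c.1.2 c.1.1 c.2)
      simp only at this
      rw [this, Fintype.sum_prod_type] at hneg
      exact hneg
  obtain ⟨μ, m0, m1, m2, m3⟩ := convexHull_min hsub hTconv hmem
  have h := sum_meanGain_nonneg (μ := fun p z => (n : ℝ)⁻¹ * μ p z) hsum hQ
    (fun p z => mul_nonneg (by positivity) (m0 p z))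
    (fun x z => by
      rw [← Finset.mul_sum, m1]; exact inv_mul_cancel_left₀ hn'.ne' _)
    (fun x z => by
      rw [← Finset.mul_sum, m2]; exact inv_mul_cancel_left₀ hn'.ne' _)
  simp only [mul_assoc, ← Finset.mul_sum] at h
  exact absurd (nonneg_of_mul_nonneg_right h (by positivity)) (not_le.mpr m3)

/-- If any two distinct elements of `A` are related in some order, then all elements of `A` but at
most one are related to another element. -/
theorem card_le_card_filter_exists_add_one {α : Type*} [DecidableEq α] (A : Finset α)
    (r : α → α → Prop) [DecidableRel r] (h : ∀ a ∈ A, ∀ b ∈ A, r a b ∨ r b a) :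
    A.card ≤ (A.filter fun a => ∃ b ∈ A, b ≠ a ∧ r a b).card + 1 := by
  rw [← Finset.card_filter_add_card_filter_not (s := A) (p := fun a => ∃ b ∈ A, b ≠ a ∧ r a b)]
  refine Nat.add_le_add_left (Finset.card_le_one.mpr fun a ha b hb => ?_) _
  by_contra hab
  rw [mem_filter] at ha hb
  rcases h a ha.1 b hb.1 with hr | hr
  · exact ha.2 ⟨b, hb.1, Ne.symm hab, hr⟩
  · exact hb.2 ⟨a, ha.1, hab, hr⟩

open Classical in
/-- The side sequences `z` of joint type `J` with the codeword `x` for which another codeword of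
joint type `J` with `z` has nonnegative mean gain over `x`. -/
def goodSide {X Y Z : Type*} [Fintype X] [Fintype Y] [Fintype Z] {n : ℕ} (q : X → Y → ℝ)
    (Q : X → Y × Z → ℝ) (J : X → Z → ℕ) (C : Finset (Fin n → X)) (x : Fin n → X) :
    Finset (Fin n → Z) :=
  (condClass x J).filter fun z =>
    ∃ x' ∈ C, x' ≠ x ∧ z ∈ condClass x' J ∧ 0 ≤ ∑ i, meanGain q Q (x i) (x' i) (z i)

/-- For each `z` at most one codeword of joint type `J` with `z` lacks a competitor. -/
theorem sum_card_condClass_le {X Y Z : Type*} [Fintype X] [Fintype Y] [Fintype Z] {n : ℕ}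
    {q : X → Y → ℝ} {Q : X → Y × Z → ℝ} {J : X → Z → ℕ} (C : Finset (Fin n → X))
    (hJ : ∀ (x x' : Fin n → X) (z : Fin n → Z), z ∈ condClass x J → z ∈ condClass x' J →
        0 ≤ ∑ i, (meanGain q Q (x i) (x' i) (z i) + meanGain q Q (x' i) (x i) (z i))) :
    ∑ x ∈ C, (condClass x J).card ≤ ∑ x ∈ C, (goodSide q Q J C x).card +
      (condClass (fun _ : Fin n => ()) fun _ ζ => ∑ a, J a ζ).card := by
  classical
  have e : ∀ S : (Fin n → X) → Finset (Fin n → Z), ∑ x ∈ C, (S x).card =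
      ∑ z, (C.filter fun x => z ∈ S x).card := fun S => by
    have : ∀ x, (S x).card = ∑ z, if z ∈ S x then 1 else 0 := fun x => by simp
    simp only [this]
    rw [Finset.sum_comm]
    exact Finset.sum_congr rfl fun z _ => by rw [Finset.card_filter]
  set D := condClass (fun _ : Fin n => ()) fun _ ζ => ∑ a, J a ζ with hD
  have e' : D.card = ∑ z, if z ∈ D then 1 else 0 := by simp
  rw [e, e, e', ← Finset.sum_add_distrib]
  refine Finset.sum_le_sum fun z _ => ?_
  split_ifs with hz
  · have h := card_le_card_filter_exists_add_one (C.filter fun x => z ∈ condClass x J)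
      (fun x x' => 0 ≤ ∑ i, meanGain q Q (x i) (x' i) (z i)) (fun x hx x' hx' => ?_)
    · refine h.trans (Nat.add_le_add_right (Finset.card_le_card fun x hx => ?_) 1)
      simp only [mem_filter] at hx
      obtain ⟨⟨h1, h2⟩, x', ⟨h3, h4⟩, h5, h6⟩ := hx
      exact mem_filter.mpr ⟨h1, mem_filter.mpr ⟨h2, x', h3, h5, h4, h6⟩⟩
    · have h := hJ x x' z (mem_filter.mp hx).2 (mem_filter.mp hx').2
      rw [Finset.sum_add_distrib] at h
      by_contra! hc
      linarith [hc.1, hc.2]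
  · rw [Finset.filter_eq_empty_iff.mpr, Finset.card_empty]
    · exact Nat.zero_le _
    · intro x _ hx
      refine hz (mem_condClass.mpr fun a ζ => ?_)
      have h1 := count_comp (fun i => (x i, z i)) (fun c => ((), c.2)) (a, ζ)
      simp only [Fintype.sum_prod_type, Prod.mk.injEq, true_and] at h1
      rw [h1]
      refine Finset.sum_congr rfl fun b _ => ?_
      rw [← mem_condClass.mp hx b ζ]
      simp

/-! ### Output sequences near the reference distribution -/

/-- The entropy of a subdivision of the mass `t` by a probability vector. -/
theorem sum_negMulLog_mul {B : Type*} [Fintype B] {t : ℝ} {p : B → ℝ}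
    (hp : t ≠ 0 → ∑ b, p b = 1) :
    ∑ b, negMulLog (t * p b) - negMulLog t = t * ∑ b, negMulLog (p b) := by
  simp only [negMulLog_mul, Finset.sum_add_distrib, ← Finset.sum_mul, ← Finset.mul_sum]
  rcases eq_or_ne t 0 with rfl | h
  · simp
  · rw [hp h]; ring

/-- The joint counts of `(x, y, z)` are within `|X| + 1` of those expected under `n P × Q`, and
vanish where these vanish. -/
def IsNear {X Y Z : Type*} [Fintype X] {n : ℕ} (P : X → ℝ) (Q : X → Y × Z → ℝ)
    (x : Fin n → X) (y : Fin n → Y) (z : Fin n → Z) : Prop :=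
  ∀ a b ζ, |(count (fun i => ((x i, y i), z i)) ((a, b), ζ) : ℝ) - n * (P a * Q a (b, ζ))| ≤
      Fintype.card X + 1 ∧
    (P a * Q a (b, ζ) = 0 → count (fun i => ((x i, y i), z i)) ((a, b), ζ) = 0)

/-- There are many outputs `y` which are near the reference distribution and whose metric with the
competitor `x'` is at least that with `x`. The joint type of `((x, x', z), y)` is a rounding of
the joint type of `(x, x', z)` times `P_{Y|XZ}`, chosen so that the metric gain does not fall
below its mean. -/
theorem exists_confusing_outputs {X Y Z : Type*} [Fintype X] [Fintype Y] [Fintype Z] {n : ℕ}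
    (hn : 0 < n) {q : X → Y → ℝ} {P : X → ℝ} {Q : X → Y × Z → ℝ}
    (hQ : IsChannel Q) {J : X → Z → ℕ}
    (hJ : ∀ a ζ, |(J a ζ : ℝ) - n * (P a * margZ Q a ζ)| ≤ 1)
    (hJ0 : ∀ a ζ, n * (P a * margZ Q a ζ) = 0 → J a ζ = 0) {x x' : Fin n → X} {z : Fin n → Z}
    (hz : z ∈ condClass x J) (hgain : 0 ≤ ∑ i, meanGain q Q (x i) (x' i) (z i)) :
    ∃ S : Finset (Fin n → Y), (∀ y ∈ S, IsNear P Q x y z ∧ seqMetric q x y ≤ seqMetric q x' y) ∧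
      exp (∑ a, ∑ b, ∑ ζ, negMulLog (n * (P a * Q a (b, ζ)))
        - ∑ a, ∑ ζ, negMulLog (n * (P a * margZ Q a ζ))
        - (3 * Fintype.card (X × X × Z) * Fintype.card Y
            + Fintype.card X * Fintype.card Z * Fintype.card Y) * logUnit n) ≤ (S.card : ℝ) := by
  classical
  have hL := one_le_logUnit n
  set s : Fin n → X × X × Z := fun i => (x i, x' i, z i) with hs
  set κ : X × X × Z → Y → ℝ := fun c y => backKernel Q c.1 c.2.2 y with hκ
  set v : X × X × Z → Y → ℝ := fun c y => count s c * κ c y with hv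
  have hmargJ : ∀ a ζ, ∑ a', count s (a, a', ζ) = J a ζ := fun a ζ => by
    rw [← mem_condClass.mp hz a ζ, count_comp s (fun c => (c.1, c.2.2)) (a, ζ)]
    simp only [Fintype.sum_prod_type, Prod.mk.injEq, ite_and]
    rw [Finset.sum_comm]
    simp
  have hκsum : ∀ c, (count s c : ℝ) ≠ 0 → ∑ y, κ c y = 1 := fun c hc => by
    refine sum_backKernel fun h0 => hc ?_
    have h1 := hJ0 c.1 c.2.2 (by rw [h0]; ring)
    rw [← hmargJ] at h1
    exact_mod_cast (Finset.sum_eq_zero_iff.mp h1) c.2.1 (mem_univ _)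
  have hv0 : ∀ c y, 0 ≤ v c y := fun c y =>
    mul_nonneg (Nat.cast_nonneg _) (backKernel_nonneg hQ _ _ _)
  have hvs : ∀ c, ∑ y, v c y = count s c := fun c => by
    simp only [hv, ← Finset.mul_sum]
    rcases eq_or_ne (count s c : ℝ) 0 with h | h
    · rw [h, zero_mul]
    · rw [hκsum c h, mul_one]
  have hvn : ∀ c y, v c y ≤ n := fun c y => by
    refine (Finset.single_le_sum (f := fun y => v c y) (fun y _ => hv0 c y) (mem_univ y)).trans ?_
    rw [hvs]; exact_mod_cast count_le s c
  have hmem := mem_convexHull_roundings v fun c => ⟨count s c, by rw [hvs]; simp⟩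
  -- a rounding whose metric gain is at least the mean gain
  obtain ⟨w, hw, hwgain⟩ : ∃ w ∈ roundings v,
      0 ≤ ∑ c, ∑ y, w c y * (q c.2.1 y - q c.1 y) := by
    by_contra! hcon
    have hlin : IsLinearMap ℝ
        fun w : X × X × Z → Y → ℝ => ∑ c, ∑ y, w c y * (q c.2.1 y - q c.1 y) :=
      ⟨fun w w' => by simp only [Pi.add_apply, add_mul, Finset.sum_add_distrib],
        fun r w => by simp only [Pi.smul_apply, smul_eq_mul, Finset.mul_sum, mul_assoc]⟩
    have h1 := convexHull_min hcon (convex_halfSpace_lt hlin 0) hmem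
    have h2 := sum_comp_eq_count s (fun c => meanGain q Q c.1 c.2.1 c.2.2)
    simp only [hs] at h2
    rw [h2] at hgain
    refine absurd hgain (not_le.mpr (lt_of_eq_of_lt ?_ h1))
    refine Finset.sum_congr rfl fun c _ => ?_
    simp only [meanGain, Finset.mul_sum, hv, hκ, hs]
    exact Finset.sum_congr rfl fun y _ => by ring
  obtain ⟨K, k1, k2, k3, k4⟩ := exists_nat_of_mem_roundings hv0 hw
  have hK : ∀ c, ∑ y, K c y = count s c := fun c => by exact_mod_cast (k4 c).trans (hvs c)
  have hgX : ∀ a ζ y, (n : ℝ) * (P a * Q a (y, ζ)) =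
      n * (P a * margZ Q a ζ) * backKernel Q a ζ y := fun a ζ y => by
    rw [← backKernel_mul_margZ hQ]; ring
  refine ⟨condClass s K, fun y hy => ⟨fun a b ζ => ?_, ?_⟩, ?_⟩
  · have e1 : count (fun i => ((x i, y i), z i)) ((a, b), ζ) = ∑ a', K (a, a', ζ) b := by
      rw [count_comp (fun i => (s i, y i)) (fun c => ((c.1.1, c.2), c.1.2.2)) ((a, b), ζ)]
      simp only [Fintype.sum_prod_type, Prod.mk.injEq, ite_and]
      rw [Finset.sum_comm]
      simp [mem_condClass.mp hy]
    have e2 : ∑ a', v (a, a', ζ) b = J a ζ * backKernel Q a ζ b := by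
      simp only [hv, hκ, ← Finset.sum_mul]
      rw [← Nat.cast_sum, hmargJ]
    rw [e1]
    constructor
    · have h1 : |∑ a', ((K (a, a', ζ) b : ℝ) - v (a, a', ζ) b)| ≤ Fintype.card X := by
        refine (Finset.abs_sum_le_sum_abs _ _).trans ?_
        refine (Finset.sum_le_sum fun a' _ => k2 (a, a', ζ) b).trans ?_
        simp
      have h2 : |(J a ζ : ℝ) * backKernel Q a ζ b -
          n * (P a * margZ Q a ζ) * backKernel Q a ζ b| ≤ 1 := by
        rw [← sub_mul, abs_mul, abs_of_nonneg (backKernel_nonneg hQ _ _ _)]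
        exact mul_le_one₀ (hJ a ζ) (backKernel_nonneg hQ _ _ _) (backKernel_le_one hQ _ _ _)
      rw [Finset.sum_sub_distrib, e2] at h1
      rw [hgX, Nat.cast_sum]
      rw [abs_le] at h1 h2 ⊢
      constructor <;> linarith [h1.1, h1.2, h2.1, h2.2]
    · intro h0
      refine Finset.sum_eq_zero fun a' _ => k3 _ _ ?_
      have h1 := hgX a ζ b
      rw [h0, mul_zero, eq_comm, mul_eq_zero] at h1
      rcases h1 with h1 | h1
      · have h2 := hJ0 a ζ h1
        rw [← hmargJ, Finset.sum_eq_zero_iff] at h2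
        simp only [hv, h2 a' (mem_univ _), Nat.cast_zero, zero_mul]
      · simp only [hv, hκ, h1, mul_zero]
  · have h1 := sum_comp_eq_count (fun i => (s i, y i)) (fun c => q c.1.2.1 c.2 - q c.1.1 c.2)
    simp only [Fintype.sum_prod_type (α₁ := X × X × Z), mem_condClass.mp hy, ← k1] at h1
    rw [← h1] at hwgain
    simp only [hs, Finset.sum_sub_distrib, sub_nonneg] at hwgain
    exact mul_le_mul_of_nonneg_left hwgain (by positivity)
  · refine le_trans (exp_le_exp.mpr ?_) (le_card_condClass s K hK)
    have h1 : ∑ c, ∑ y, negMulLog (v c y) - ∑ c : X × X × Z, ∑ _y : Y, 2 * logUnit n ≤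
        ∑ c, ∑ y, negMulLog (K c y) := by
      simp only [← Finset.sum_sub_distrib]
      refine Finset.sum_le_sum fun c _ => Finset.sum_le_sum fun y _ => ?_
      have hKn : (K c y : ℝ) ≤ n := by
        have := (Finset.single_le_sum (f := fun y => K c y) (fun _ _ => Nat.zero_le _)
          (mem_univ y)).trans ((hK c).le.trans (count_le s c))
        exact_mod_cast this
      have := abs_negMulLog_sub_le hn (Nat.cast_nonneg _) (hv0 c y) hKn (hvn c y) (k2 c y)
      rw [abs_le] at this
      linarith [this.1]
    have h2 : ∑ c, ∑ y, negMulLog (v c y) - ∑ c, negMulLog (count s c) =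
        ∑ a, ∑ ζ, (J a ζ : ℝ) * ∑ y, negMulLog (backKernel Q a ζ y) := by
      rw [← Finset.sum_sub_distrib]
      simp only [hv]
      rw [Finset.sum_congr rfl fun c _ => sum_negMulLog_mul (hκsum c), Fintype.sum_prod_type]
      refine Finset.sum_congr rfl fun a _ => ?_
      rw [Fintype.sum_prod_type_right]
      refine Finset.sum_congr rfl fun ζ _ => ?_
      rw [← hmargJ, Nat.cast_sum, Finset.sum_mul]
    have h3 : ∑ a, ∑ b, ∑ ζ, negMulLog (n * (P a * Q a (b, ζ)))
        - ∑ a, ∑ ζ, negMulLog (n * (P a * margZ Q a ζ)) =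
        ∑ a, ∑ ζ, n * (P a * margZ Q a ζ) * ∑ y, negMulLog (backKernel Q a ζ y) := by
      rw [← Finset.sum_sub_distrib]
      refine Finset.sum_congr rfl fun a _ => ?_
      rw [Finset.sum_comm, ← Finset.sum_sub_distrib]
      refine Finset.sum_congr rfl fun ζ _ => ?_
      simp only [hgX]
      refine sum_negMulLog_mul fun h => sum_backKernel fun h0 => h ?_
      rw [h0]; ring
    have h4 : ∑ a, ∑ ζ, n * (P a * margZ Q a ζ) * ∑ y, negMulLog (backKernel Q a ζ y) ≤
        ∑ a, ∑ ζ, (J a ζ : ℝ) * ∑ y, negMulLog (backKernel Q a ζ y) +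
          ∑ _a : X, ∑ _ζ : Z, (Fintype.card Y : ℝ) := by
      simp only [← Finset.sum_add_distrib]
      refine Finset.sum_le_sum fun a _ => Finset.sum_le_sum fun ζ _ => ?_
      have hH0 : 0 ≤ ∑ y, negMulLog (backKernel Q a ζ y) := Finset.sum_nonneg fun y _ =>
        negMulLog_nonneg (backKernel_nonneg hQ _ _ _) (backKernel_le_one hQ _ _ _)
      have hH1 : ∑ y, negMulLog (backKernel Q a ζ y) ≤ Fintype.card Y := by
        refine (Finset.sum_le_sum (g := fun _ => (1 : ℝ)) fun y _ => ?_).trans (by simp)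
        have := backKernel_nonneg hQ a ζ y
        exact (negMulLog_le_one_sub_self this).trans (by linarith)
      have := (abs_le.mp (hJ a ζ)).1
      nlinarith
    simp only [Finset.sum_const, Finset.card_univ, nsmul_eq_mul] at h1 h4
    have h5 : (Fintype.card X : ℝ) * (Fintype.card Z * Fintype.card Y) ≤
        Fintype.card X * (Fintype.card Z * Fintype.card Y) * logUnit n :=
      le_mul_of_one_le_right (by positivity) hL
    linarith

theorem add_one_le_exp_logUnit {n : ℕ} (hn : 0 < n) : (n : ℝ) + 1 ≤ exp (logUnit n) := by
  have hn' : (1 : ℝ) ≤ n := by exact_mod_cast hn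
  have := add_one_le_exp (1 : ℝ)
  rw [logUnit, exp_add, exp_log (by linarith)]
  nlinarith

theorem isChannel_margY {X Y Z : Type*} [Fintype Y] [Fintype Z] {Q : X → Y × Z → ℝ}
    (hQ : IsChannel Q) : IsChannel (margY Q) := fun x =>
  ⟨fun y => Finset.sum_nonneg fun z _ => (hQ x).1 (y, z), by
    rw [← (hQ x).2, Fintype.sum_prod_type]; rfl⟩

theorem isChannel_margZ {X Y Z : Type*} [Fintype Y] [Fintype Z] {Q : X → Y × Z → ℝ}
    (hQ : IsChannel Q) : IsChannel (margZ Q) := fun x =>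
  ⟨margZ_nonneg hQ x, sum_margZ hQ x⟩

section Reference

variable {X Y Z : Type*} [Fintype X] [Fintype Y] [Fintype Z] {n : ℕ} {P : X → ℝ}
  {Q : X → Y × Z → ℝ}

theorem le_one_of_mem_stdSimplex {A : Type*} [Fintype A] {p : A → ℝ} (hp : p ∈ stdSimplex ℝ A)
    (a : A) : p a ≤ 1 :=
  hp.2 ▸ Finset.single_le_sum (fun a _ => hp.1 a) (mem_univ a)

theorem mul_channel_mem {B : Type*} [Fintype B] {V : X → B → ℝ} (hP : P ∈ stdSimplex ℝ X)
    (hV : IsChannel V) (a : X) (b : B) :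
    0 ≤ (n : ℝ) * (P a * V a b) ∧ (n : ℝ) * (P a * V a b) ≤ n := by
  have h0 := hP.1 a
  have h1 := (hV a).1 b
  refine ⟨by positivity, mul_le_of_le_one_right (by positivity) ?_⟩
  exact mul_le_one₀ (le_one_of_mem_stdSimplex hP a) h1 (le_one_of_mem_stdSimplex (hV a) b)

theorem IsNear.abs_count_sub_le {x : Fin n → X} {y : Fin n → Y} {z : Fin n → Z}
    (h : IsNear P Q x y z) (a : X) (b : Y) :
    |(count (fun i => (x i, y i)) (a, b) : ℝ) - n * (P a * margY Q a b)| ≤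
      Fintype.card Z * (Fintype.card X + 1) := by
  rw [← sum_count_pair (fun i => (x i, y i)) z (a, b)]
  simp only [margY, Finset.mul_sum, Nat.cast_sum]
  rw [← Finset.sum_sub_distrib]
  refine (Finset.abs_sum_le_sum_abs _ _).trans ?_
  refine (Finset.sum_le_sum fun ζ _ => (h a b ζ).1).trans ?_
  rw [Finset.sum_const, Finset.card_univ, nsmul_eq_mul]

theorem IsNear.count_eq_zero (hP : P ∈ stdSimplex ℝ X) (hQ : IsChannel Q) {x : Fin n → X}
    {y : Fin n → Y} {z : Fin n → Z} (h : IsNear P Q x y z) {a : X} {b : Y}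
    (h0 : P a * margY Q a b = 0) : count (fun i => (x i, y i)) (a, b) = 0 := by
  rw [← sum_count_pair (fun i => (x i, y i)) z (a, b)]
  refine Finset.sum_eq_zero fun ζ _ => (h a b ζ).2 ?_
  rw [margY, Finset.mul_sum, Finset.sum_eq_zero_iff_of_nonneg
    fun ζ _ => mul_nonneg (hP.1 a) ((hQ a).1 _)] at h0
  exact h0 ζ (mem_univ _)

open Classical in
/-- Few side sequences `z` are near the reference distribution jointly with given `x` and `y`:
there are polynomially many joint types, each of which contributes at most the exponential of the
conditional entropy of `Z` given `(X, Y)`. -/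
theorem card_isNear_le (hn : 0 < n) (hP : P ∈ stdSimplex ℝ X) (hQ : IsChannel Q)
    (x : Fin n → X) (y : Fin n → Y) :
    ((univ.filter fun z => IsNear P Q x y z).card : ℝ) ≤
      exp (∑ a, ∑ b, ∑ ζ, negMulLog (n * (P a * Q a (b, ζ)))
        - ∑ a, ∑ b, negMulLog (n * (P a * margY Q a b))
        + (Fintype.card X * Fintype.card Y * Fintype.card Z * (Fintype.card X + 3)
          + Fintype.card X * Fintype.card Y * (Fintype.card Z * (Fintype.card X + 1) + 1))
          * logUnit n) := by
  set M := exp (∑ a, ∑ b, ∑ ζ, negMulLog (n * (P a * Q a (b, ζ)))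
        - ∑ a, ∑ b, negMulLog (n * (P a * margY Q a b))
        + (Fintype.card X * Fintype.card Y * Fintype.card Z * (Fintype.card X + 2)
          + Fintype.card X * Fintype.card Y * (Fintype.card Z * (Fintype.card X + 1) + 1))
          * logUnit n) with hM
  set D := univ.filter fun z => IsNear P Q x y z with hD
  set f : (Fin n → Z) → (X × Y) × Z → ℕ := fun z => count (fun i => ((x i, y i), z i)) with hf
  have hfib : ∀ z₀ ∈ D, ((D.filter fun z => f z = f z₀).card : ℝ) ≤ M := by
    intro z₀ hz₀
    have hnear : IsNear P Q x y z₀ := (mem_filter.mp hz₀).2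
    have hsub : (D.filter fun z => f z = f z₀) ⊆
        condClass (fun i => (x i, y i)) (fun c ζ => f z₀ (c, ζ)) := fun z hz =>
      mem_condClass.mpr fun c ζ => congrFun (mem_filter.mp hz).2 (c, ζ)
    refine (Nat.cast_le.mpr (Finset.card_le_card hsub)).trans
      ((card_condClass_le _ _).trans (exp_le_exp.mpr ?_))
    simp only [Fintype.sum_prod_type]
    have h1 : ∑ a, ∑ b, ∑ ζ, negMulLog (f z₀ ((a, b), ζ)) ≤
        ∑ a, ∑ b, ∑ ζ, negMulLog (n * (P a * Q a (b, ζ))) +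
          ∑ _a : X, ∑ _b : Y, ∑ _ζ : Z, ((Fintype.card X : ℝ) + 1 + 1) * logUnit n := by
      simp only [← Finset.sum_add_distrib]
      refine Finset.sum_le_sum fun a _ => Finset.sum_le_sum fun b _ =>
        Finset.sum_le_sum fun ζ _ => ?_
      have hm := mul_channel_mem (n := n) hP hQ a (b, ζ)
      have := abs_negMulLog_sub_le hn (Nat.cast_nonneg _) hm.1
        (by exact_mod_cast count_le _ _) hm.2 (hnear a b ζ).1
      linarith [(abs_le.mp this).2]
    have h2 : ∑ a, ∑ b, negMulLog (n * (P a * margY Q a b)) -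
          ∑ _a : X, ∑ _b : Y, (Fintype.card Z * ((Fintype.card X : ℝ) + 1) + 1) * logUnit n ≤
        ∑ a, ∑ b, negMulLog (count (fun i => (x i, y i)) (a, b)) := by
      simp only [← Finset.sum_sub_distrib]
      refine Finset.sum_le_sum fun a _ => Finset.sum_le_sum fun b _ => ?_
      have hm := mul_channel_mem (n := n) hP (isChannel_margY hQ) a b
      have := abs_negMulLog_sub_le hn (Nat.cast_nonneg _) hm.1
        (by exact_mod_cast count_le _ _) hm.2 (hnear.abs_count_sub_le a b)
      linarith [(abs_le.mp this).1]
    simp only [Finset.sum_const, Finset.card_univ, nsmul_eq_mul] at h1 h2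
    linarith
  have himg : ((D.image f).card : ℝ) ≤
      exp (Fintype.card X * Fintype.card Y * Fintype.card Z * logUnit n) := by
    have hsub : D.image f ⊆ Fintype.piFinset fun _ : (X × Y) × Z => range (n + 1) := by
      intro g hg
      obtain ⟨z, _, rfl⟩ := mem_image.mp hg
      exact Fintype.mem_piFinset.mpr fun c => mem_range.mpr (Nat.lt_succ_of_le (count_le _ _))
    refine (Nat.cast_le.mpr (Finset.card_le_card hsub)).trans ?_
    rw [Fintype.card_piFinset]
    simp only [card_range, Finset.prod_const, Finset.card_univ, Fintype.card_prod]
    rw [show (Fintype.card X * Fintype.card Y * Fintype.card Z * logUnit n : ℝ) =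
      ((Fintype.card X * Fintype.card Y * Fintype.card Z : ℕ) : ℝ) * logUnit n by push_cast; ring,
      exp_nat_mul]
    push_cast
    exact pow_le_pow_left₀ (by positivity) (add_one_le_exp_logUnit hn) _
  calc (D.card : ℝ) = ∑ g ∈ D.image f, ((D.filter fun z => f z = g).card : ℝ) := by
        rw [Finset.card_eq_sum_card_image f D, Nat.cast_sum]
    _ ≤ ∑ _g ∈ D.image f, M := Finset.sum_le_sum fun g hg => by
        obtain ⟨z₀, hz₀, rfl⟩ := mem_image.mp hg
        exact hfib z₀ hz₀
    _ = (D.image f).card * M := by rw [Finset.sum_const, nsmul_eq_mul]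
    _ ≤ exp (Fintype.card X * Fintype.card Y * Fintype.card Z * logUnit n) * M :=
        mul_le_mul_of_nonneg_right himg (exp_pos _).le
    _ = _ := by
        rw [hM, ← exp_add]
        congr 1
        ring

/-- The probability under `W` of an output near the reference distribution. -/
theorem le_chanPow {W : X → Y → ℝ} (hP : P ∈ stdSimplex ℝ X) (hQ : IsChannel Q)
    (hW : IsChannel W) {w : ℝ} (hw0 : 0 < w) (hw : ∀ a b, 0 < W a b → w ≤ W a b)
    (hPW : ∀ a b, P a * W a b = 0 → P a * margY Q a b = 0) {x : Fin n → X} {y : Fin n → Y}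
    {z : Fin n → Z} (h : IsNear P Q x y z) :
    exp (∑ a, ∑ b, n * (P a * margY Q a b) * log (W a b)
      - Fintype.card X * Fintype.card Y * (Fintype.card Z * (Fintype.card X + 1)) * |log w|) ≤
      chanPow W x y := by
  have e := prod_comp_eq_count (fun i => (x i, y i)) (fun c => W c.1 c.2)
  simp only at e
  rw [chanPow, e, Fintype.prod_prod_type]
  have hc : (Fintype.card X * Fintype.card Y * (Fintype.card Z * (Fintype.card X + 1)) * |log w| :
      ℝ) = ∑ _a : X, ∑ _b : Y, Fintype.card Z * ((Fintype.card X : ℝ) + 1) * |log w| := by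
    simp only [Finset.sum_const, Finset.card_univ, nsmul_eq_mul]; ring
  rw [hc]
  simp only [← Finset.sum_sub_distrib, exp_sum]
  refine Finset.prod_le_prod (fun a _ => Finset.prod_nonneg fun b _ => (exp_pos _).le)
    fun a _ => Finset.prod_le_prod (fun b _ => (exp_pos _).le) fun b _ => ?_
  rcases ((hW a).1 b).eq_or_lt with h0 | hpos
  · rw [h.count_eq_zero hP hQ (hPW a b (by rw [← h0, mul_zero])), pow_zero, ← h0, log_zero,
      mul_zero, zero_sub, exp_le_one_iff, neg_nonpos]
    positivity
  · rw [← rpow_natCast, rpow_def_of_pos hpos]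
    refine exp_le_exp.mpr ?_
    have hl0 : log (W a b) ≤ 0 := log_nonpos hpos.le (le_one_of_mem_stdSimplex (hW a) b)
    have hl1 : log w ≤ log (W a b) := log_le_log hw0 (hw a b hpos)
    have hl2 : |log (W a b)| ≤ |log w| := by
      rw [abs_of_nonpos hl0, abs_of_nonpos (hl1.trans hl0)]; linarith
    have h1 := mul_le_mul (h.abs_count_sub_le a b) hl2 (abs_nonneg _) (by positivity)
    rw [← abs_mul] at h1
    linarith [(abs_le.mp h1).1]

/-! ### Information measures in terms of the entropy function -/

theorem mul_mutualInfo_eq {A B : Type*} [Fintype A] [Fintype B] (t : ℝ) {J : A → B → ℝ}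
    (hJ : ∀ a b, 0 ≤ J a b) (h1 : ∑ a, ∑ b, J a b = 1) :
    t * mutualInfo J = ∑ a, negMulLog (t * ∑ b, J a b) + ∑ b, negMulLog (t * ∑ a, J a b)
      - ∑ a, ∑ b, negMulLog (t * J a b) - negMulLog t := by
  have h1' : ∑ b, ∑ a, J a b = 1 := by rw [Finset.sum_comm, h1]
  have key : mutualInfo J = ∑ a, negMulLog (∑ b, J a b) + ∑ b, negMulLog (∑ a, J a b)
      - ∑ a, ∑ b, negMulLog (J a b) := by
    have e : ∀ a b, J a b * log (J a b / ((∑ b', J a b') * (∑ a', J a' b))) =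
        J a b * -log (∑ b', J a b') + J a b * -log (∑ a', J a' b) - negMulLog (J a b) := by
      intro a b
      rcases (hJ a b).eq_or_lt with h0 | h0
      · rw [← h0]; simp
      have ha : 0 < ∑ b', J a b' :=
        h0.trans_le (Finset.single_le_sum (f := fun b => J a b) (fun b _ => hJ a b) (mem_univ b))
      have hb : 0 < ∑ a', J a' b :=
        h0.trans_le (Finset.single_le_sum (f := fun a => J a b) (fun a _ => hJ a b) (mem_univ a))
      rw [log_div h0.ne' (mul_pos ha hb).ne', log_mul ha.ne' hb.ne', negMulLog]
      ring
    simp only [mutualInfo, e, Finset.sum_sub_distrib, Finset.sum_add_distrib]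
    congr 2
    · exact Finset.sum_congr rfl fun a _ => by rw [← Finset.sum_mul, negMulLog]; ring
    · rw [Finset.sum_comm]
      exact Finset.sum_congr rfl fun a _ => by rw [← Finset.sum_mul, negMulLog]; ring
  simp only [negMulLog_mul t, Finset.sum_add_distrib, ← Finset.sum_mul, ← Finset.mul_sum]
  rw [h1, h1', key]
  ring

theorem mul_condDiv_eq {V W : X → Y → ℝ} (t : ℝ) (hV : IsChannel V)
    (hPW : ∀ a b, P a * W a b = 0 → P a * V a b = 0) :
    t * ∑ a, ∑ b, P a * V a b * log (V a b / W a b) =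
      ∑ a, negMulLog (t * P a) - ∑ a, ∑ b, negMulLog (t * (P a * V a b))
        - ∑ a, ∑ b, t * (P a * V a b) * log (W a b) := by
  rw [Finset.mul_sum, ← Finset.sum_sub_distrib, ← Finset.sum_sub_distrib]
  refine Finset.sum_congr rfl fun a _ => ?_
  have h1 : ∑ b, negMulLog (t * (P a * V a b)) - negMulLog (t * P a) =
      t * P a * ∑ b, negMulLog (V a b) := by
    simp only [← mul_assoc]
    exact sum_negMulLog_mul fun _ => (hV a).2
  have h2 : t * ∑ b, P a * V a b * log (V a b / W a b) =
      -(t * P a * ∑ b, negMulLog (V a b)) - ∑ b, t * (P a * V a b) * log (W a b) := by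
    rw [Finset.mul_sum, Finset.mul_sum, ← Finset.sum_neg_distrib, ← Finset.sum_sub_distrib]
    refine Finset.sum_congr rfl fun b _ => ?_
    rcases eq_or_ne (V a b) 0 with hv | hv
    · simp [hv]
    rcases eq_or_ne (W a b) 0 with hw | hw
    · have h3 := hPW a b (by rw [hw, mul_zero])
      have h4 : P a = 0 := by simpa [hv] using h3
      simp [h4]
    · rw [log_div hv hw, negMulLog]; ring
  rw [h2, ← h1]; ring

end Reference

/-! ### The decoder errs on confusing outputs -/

theorem decodeProb_le_one {X Y : Type*} {q : X → Y → ℝ} {n : ℕ} {C : Finset (Fin n → X)}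
    {y : Fin n → Y} {x : Fin n → X} : decodeProb q C y x ≤ 1 := by
  unfold decodeProb; split_ifs with h
  · exact div_le_one_of_le₀ (by exact_mod_cast Finset.card_pos.mpr ⟨x, h⟩) (Nat.cast_nonneg _)
  · exact zero_le_one

theorem decodeProb_le_half {X Y : Type*} {q : X → Y → ℝ} {n : ℕ} {C : Finset (Fin n → X)}
    {y : Fin n → Y} {x x' : Fin n → X} (hx' : x' ∈ C) (hne : x' ≠ x)
    (hq : seqMetric q x y ≤ seqMetric q x' y) : decodeProb q C y x ≤ 1 / 2 := by
  classical
  unfold decodeProb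
  split_ifs with h
  · have h2 : x' ∈ maximizers q C y := by
      simp only [maximizers, mem_filter] at h ⊢
      exact ⟨hx', fun x'' hx'' => (h.2 x'' hx'').trans hq⟩
    have h3 : 2 ≤ (maximizers q C y).card := by
      rw [← Finset.card_pair hne]
      exact Finset.card_le_card (by
        intro u hu
        rcases mem_insert.mp hu with rfl | hu
        · exact h2
        · rwa [mem_singleton.mp hu])
    exact one_div_le_one_div_of_le two_pos (by exact_mod_cast h3)
  · norm_num

/-! ### The lower bound on the error probability -/

/-- The coefficient of `(log n + 1) / n` in the rate loss. -/
def rateConst (X Z : Type*) [Fintype X] [Fintype Z] : ℝ :=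
  3 * Fintype.card X * Fintype.card Z + Fintype.card Z * (Fintype.card X + 1) + 1

/-- The coefficient of `(log n + 1) / n` in the exponent loss, for channels whose positive
transition probabilities are at least `w`. -/
def exponentConst (X Y Z : Type*) [Fintype X] [Fintype Y] [Fintype Z] (w : ℝ) : ℝ :=
  3 * Fintype.card X * Fintype.card Z
    + (3 * Fintype.card (X × X × Z) * Fintype.card Y
        + Fintype.card X * Fintype.card Z * Fintype.card Y)
    + (Fintype.card X * Fintype.card Y * Fintype.card Z * (Fintype.card X + 3)
        + Fintype.card X * Fintype.card Y * (Fintype.card Z * (Fintype.card X + 1) + 1))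
    + Fintype.card X * Fintype.card Y * (Fintype.card Z * (Fintype.card X + 1)) * |log w|
    + 2

section Main

variable {X Y Z : Type*} [Fintype X] [Fintype Y] [Fintype Z] {n : ℕ} {P : X → ℝ}
  {Q : X → Y × Z → ℝ}

/-- Above the rate `I(X;Z)`, for at least half of the pairs `(x, z)` of joint type `J` the
codeword `x` has a competitor: by the size of the code, these pairs are at least twice as many as
the sequences `z`. -/
theorem le_sum_card_goodSide {q : X → Y → ℝ} (hn : 0 < n) (hP : P ∈ stdSimplex ℝ X)
    (hQ : IsChannel Q) {J : X → Z → ℕ} {C : Finset (Fin n → X)}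
    (hC : ∀ x ∈ C, ∀ a, (count x a : ℝ) = n * P a)
    {R : ℝ} (hR : exp (n * R) ≤ (C.card : ℝ))
    (hI : n * mutualInfo (fun x z => P x * margZ Q x z) + rateConst X Z * logUnit n ≤ n * R)
    (hJs : ∀ x ∈ C, ∀ a, ∑ ζ, J a ζ = count x a)
    (hJ : ∀ a ζ, |(J a ζ : ℝ) - n * (P a * margZ Q a ζ)| ≤ 1)
    (hJgain : ∀ (x x' : Fin n → X) (z : Fin n → Z), z ∈ condClass x J → z ∈ condClass x' J →
        0 ≤ ∑ i, (meanGain q Q (x i) (x' i) (z i) + meanGain q Q (x' i) (x i) (z i))) :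
    (C.card : ℝ) / 2 * exp (∑ a, ∑ ζ, negMulLog (n * (P a * margZ Q a ζ))
      - ∑ a, negMulLog (n * P a) - 3 * Fintype.card X * Fintype.card Z * logUnit n) ≤
      ∑ x ∈ C, ((goodSide q Q J C x).card : ℝ) := by
  have hL := one_le_logUnit n
  set S₁ := ∑ a, ∑ ζ, negMulLog (n * (P a * margZ Q a ζ))
      - ∑ a, negMulLog (n * P a) - 3 * Fintype.card X * Fintype.card Z * logUnit n with hS₁
  have hCpos : (0 : ℝ) < C.card := (exp_pos _).trans_le hR
  obtain ⟨x₀, hx₀⟩ : C.Nonempty := Finset.card_pos.mp (by exact_mod_cast hCpos)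
  have hJn : ∀ a ζ, J a ζ ≤ count x₀ a := fun a ζ => by
    rw [← hJs x₀ hx₀ a]
    exact Finset.single_le_sum (f := fun ζ => J a ζ) (fun _ _ => Nat.zero_le _) (mem_univ ζ)
  have hmZ := fun a ζ => mul_channel_mem (n := n) hP (isChannel_margZ hQ) a ζ
  have hclass : ∀ x ∈ C, exp S₁ ≤ ((condClass x J).card : ℝ) := by
    intro x hx
    refine le_trans (exp_le_exp.mpr ?_) (le_card_condClass x J (hJs x hx))
    have h1 : ∑ a, ∑ ζ, negMulLog (n * (P a * margZ Q a ζ)) -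
        ∑ _a : X, ∑ _ζ : Z, 2 * logUnit n ≤ ∑ a, ∑ ζ, negMulLog (J a ζ) := by
      simp only [← Finset.sum_sub_distrib]
      refine Finset.sum_le_sum fun a _ => Finset.sum_le_sum fun ζ _ => ?_
      have := abs_negMulLog_sub_le hn (Nat.cast_nonneg _) (hmZ a ζ).1
        (by exact_mod_cast (hJn a ζ).trans (count_le _ _)) (hmZ a ζ).2 (hJ a ζ)
      linarith [(abs_le.mp this).1]
    simp only [Finset.sum_const, Finset.card_univ, nsmul_eq_mul] at h1
    simp only [hC x hx]
    linarith
  -- the number of sequences `z` of the type induced by `J`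
  have hside : ((condClass (fun _ : Fin n => ()) fun _ ζ => ∑ a, J a ζ).card : ℝ) ≤
      (C.card : ℝ) / 2 * exp S₁ := by
    refine (card_condClass_le _ _).trans ?_
    have hmi := mul_mutualInfo_eq (n : ℝ) (J := fun x z => P x * margZ Q x z)
      (fun a ζ => mul_nonneg (hP.1 a) (margZ_nonneg hQ a ζ)) (by
        simp only [← Finset.mul_sum, sum_margZ hQ, mul_one]; exact hP.2)
    simp only [← Finset.mul_sum, sum_margZ hQ, mul_one] at hmi
    have h1 : ∑ ζ, negMulLog ((∑ a, J a ζ : ℕ) : ℝ) ≤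
        ∑ ζ, negMulLog (n * ∑ a, P a * margZ Q a ζ) +
          ∑ _ζ : Z, ((Fintype.card X : ℝ) + 1) * logUnit n := by
      simp only [← Finset.sum_add_distrib]
      refine Finset.sum_le_sum fun ζ _ => ?_
      have hc : |((∑ a, J a ζ : ℕ) : ℝ) - n * ∑ a, P a * margZ Q a ζ| ≤ Fintype.card X := by
        rw [Nat.cast_sum, Finset.mul_sum, ← Finset.sum_sub_distrib]
        refine (Finset.abs_sum_le_sum_abs _ _).trans ?_
        refine (Finset.sum_le_sum fun a _ => hJ a ζ).trans ?_
        simp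
      have hb1 : ∑ a, J a ζ ≤ n := by
        rw [← sum_count x₀]
        exact Finset.sum_le_sum fun a _ => hJn a ζ
      have hb2 : ∑ a, P a * margZ Q a ζ ≤ 1 := by
        rw [← hP.2]
        exact Finset.sum_le_sum fun a _ => mul_le_of_le_one_right (hP.1 a)
          (le_one_of_mem_stdSimplex (isChannel_margZ hQ a) ζ)
      have hb0 : 0 ≤ ∑ a, P a * margZ Q a ζ :=
        Finset.sum_nonneg fun a _ => mul_nonneg (hP.1 a) (margZ_nonneg hQ a ζ)
      have := abs_negMulLog_sub_le hn (Nat.cast_nonneg _)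
        (mul_nonneg (Nat.cast_nonneg n) hb0) (by exact_mod_cast hb1)
        (mul_le_of_le_one_right (Nat.cast_nonneg n) hb2) hc
      linarith [(abs_le.mp this).2]
    have hcount : count (fun _ : Fin n => ()) () = n := by simp [count]
    simp only [Finset.sum_const, Finset.card_univ, nsmul_eq_mul] at h1
    simp only [Finset.univ_unique, PUnit.default_eq_unit, Finset.sum_singleton, hcount]
    have h2 : (1 / 2 : ℝ) ≥ exp (-logUnit n) := by
      have h3 := add_one_le_exp (logUnit n)
      rw [exp_neg, ge_iff_le, ← one_div]
      exact one_div_le_one_div_of_le two_pos (by linarith)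
    calc exp (∑ ζ, negMulLog ((∑ a, J a ζ : ℕ) : ℝ) - negMulLog n)
        ≤ exp (n * R + -logUnit n + S₁) := by
          refine exp_le_exp.mpr ?_
          rw [hmi] at hI
          unfold rateConst at hI
          linarith
      _ = exp (n * R) * exp (-logUnit n) * exp S₁ := by rw [exp_add, exp_add]
      _ ≤ C.card * (1 / 2) * exp S₁ := by gcongr
      _ = _ := by ring
  have htot := sum_card_condClass_le C hJgain
  have htot' : ∑ x ∈ C, ((condClass x J).card : ℝ) ≤ ∑ x ∈ C, ((goodSide q Q J C x).card : ℝ) +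
      ((condClass (fun _ : Fin n => ()) fun _ ζ => ∑ a, J a ζ).card : ℝ) := by
    exact_mod_cast htot
  have hlow := Finset.sum_le_sum hclass
  rw [Finset.sum_const, nsmul_eq_mul] at hlow
  linarith

/-- The average error probability is at least `exp (-n D - O(log n))`. -/
theorem le_errorProb [Nonempty Z] {q : X → Y → ℝ} {W : X → Y → ℝ} (hn : 0 < n)
    (hP : P ∈ stdSimplex ℝ X) (hW : IsChannel W) {w : ℝ} (hw0 : 0 < w)
    (hw : ∀ a b, 0 < W a b → w ≤ W a b) (hQ : Q ∈ twoOutputClass q P)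
    (hPW : ∀ a b, P a * W a b = 0 → P a * margY Q a b = 0) {C : Finset (Fin n → X)}
    (hC : ∀ x ∈ C, ∀ a, (count x a : ℝ) = n * P a) {R : ℝ} (hR : exp (n * R) ≤ (C.card : ℝ))
    (hI : n * mutualInfo (fun x z => P x * margZ Q x z) + rateConst X Z * logUnit n ≤ n * R) :
    exp (-(n * ∑ a, ∑ b, P a * margY Q a b * log (margY Q a b / W a b))
      - exponentConst X Y Z w * logUnit n) ≤ errorProb q W C := by
  classical
  have hL := one_le_logUnit n
  have hCpos : (0 : ℝ) < C.card := (exp_pos _).trans_le hR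
  obtain ⟨x₀, hx₀⟩ : C.Nonempty := Finset.card_pos.mp (by exact_mod_cast hCpos)
  obtain ⟨J, hJs, hJ, hJ0, hJgain⟩ := exists_jointType hn (hC x₀ hx₀) hP.2 hQ
  have hJs' : ∀ x ∈ C, ∀ a, ∑ ζ, J a ζ = count x a := fun x hx a => by
    rw [hJs]; exact_mod_cast (hC x₀ hx₀ a).trans (hC x hx a).symm
  have hgood := le_sum_card_goodSide hn hP hQ.1 hC hR hI hJs' hJ hJgain
  set S₁ := ∑ a, ∑ ζ, negMulLog (n * (P a * margZ Q a ζ))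
      - ∑ a, negMulLog (n * P a) - 3 * Fintype.card X * Fintype.card Z * logUnit n with hS₁
  set S₂ := ∑ a, ∑ b, ∑ ζ, negMulLog (n * (P a * Q a (b, ζ)))
        - ∑ a, ∑ ζ, negMulLog (n * (P a * margZ Q a ζ))
        - (3 * Fintype.card (X × X × Z) * Fintype.card Y
            + Fintype.card X * Fintype.card Z * Fintype.card Y) * logUnit n with hS₂
  set S₃ := ∑ a, ∑ b, ∑ ζ, negMulLog (n * (P a * Q a (b, ζ)))
        - ∑ a, ∑ b, negMulLog (n * (P a * margY Q a b))
        + (Fintype.card X * Fintype.card Y * Fintype.card Z * (Fintype.card X + 3)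
          + Fintype.card X * Fintype.card Y * (Fintype.card Z * (Fintype.card X + 1) + 1))
          * logUnit n with hS₃
  set S₄ := ∑ a, ∑ b, n * (P a * margY Q a b) * log (W a b)
      - Fintype.card X * Fintype.card Y * (Fintype.card Z * (Fintype.card X + 1)) * |log w|
    with hS₄
  -- the outputs near the reference distribution which are confused with another codeword
  set E : (Fin n → X) → Finset (Fin n → Y) := fun x => univ.filter fun y =>
    (∃ x' ∈ C, x' ≠ x ∧ seqMetric q x y ≤ seqMetric q x' y) ∧ ∃ z, IsNear P Q x y z
  have hcount : ∀ x, ((goodSide q Q J C x).card : ℝ) * exp S₂ ≤ (E x).card * exp S₃ := by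
    intro x
    have h1 : ∀ z ∈ goodSide q Q J C x, ∃ S : Finset (Fin n → Y),
        (∀ y ∈ S, y ∈ E x ∧ IsNear P Q x y z) ∧ exp S₂ ≤ (S.card : ℝ) := by
      intro z hz
      obtain ⟨hzJ, x', hx', hne, -, hg⟩ := mem_filter.mp hz
      obtain ⟨S, hS, hcard⟩ := exists_confusing_outputs hn hQ.1 hJ hJ0 hzJ hg
      exact ⟨S, fun y hy => ⟨mem_filter.mpr ⟨mem_univ _, ⟨x', hx', hne, (hS y hy).2⟩,
        z, (hS y hy).1⟩, (hS y hy).1⟩, hcard⟩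
    choose! S hS hScard using h1
    have h2 : ((goodSide q Q J C x).sigma S).card ≤
        ((E x).sigma fun y => univ.filter fun z => IsNear P Q x y z).card := by
      refine Finset.card_le_card_of_injOn (fun c => ⟨c.2, c.1⟩) (fun c hc => ?_)
        (fun c _ c' _ h => ?_)
      · obtain ⟨hc1, hc2⟩ := Finset.mem_sigma.mp hc
        have := hS c.1 hc1 c.2 hc2
        exact Finset.mem_sigma.mpr ⟨this.1, mem_filter.mpr ⟨mem_univ _, this.2⟩⟩
      · obtain ⟨z, y⟩ := c
        obtain ⟨z', y'⟩ := c'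
        simp only [Sigma.mk.injEq, heq_eq_eq] at h ⊢
        exact ⟨h.2, h.1⟩
    rw [Finset.card_sigma, Finset.card_sigma] at h2
    have h2' : ∑ z ∈ goodSide q Q J C x, ((S z).card : ℝ) ≤
        ∑ y ∈ E x, ((univ.filter fun z => IsNear P Q x y z).card : ℝ) := by exact_mod_cast h2
    have h3 := Finset.sum_le_sum hScard
    have h4 : ∑ y ∈ E x, ((univ.filter fun z => IsNear P Q x y z).card : ℝ) ≤
        ∑ _y ∈ E x, exp S₃ :=
      Finset.sum_le_sum fun y _ => card_isNear_le hn hP hQ.1 x y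
    rw [Finset.sum_const, nsmul_eq_mul] at h3 h4
    exact h3.trans (h2'.trans h4)
  have herr : ∀ x, (E x).card * (exp S₄ * (1 / 2)) ≤
      ∑ y, chanPow W x y * (1 - decodeProb q C y x) := by
    intro x
    rw [← nsmul_eq_mul, ← Finset.sum_const]
    have hnn : ∀ y, 0 ≤ chanPow W x y := fun y => Finset.prod_nonneg fun i _ => (hW _).1 _
    refine le_trans (Finset.sum_le_sum fun y hy => ?_)
      (Finset.sum_le_sum_of_subset_of_nonneg (subset_univ (E x)) fun y _ _ =>
        mul_nonneg (hnn y) (sub_nonneg.mpr decodeProb_le_one))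
    obtain ⟨⟨x', hx', hne, hq⟩, z, hz⟩ := (mem_filter.mp hy).2
    have h1 := le_chanPow hP hQ.1 hW hw0 hw hPW hz
    have h2 := decodeProb_le_half hx' hne hq
    exact mul_le_mul h1 (by linarith) (by norm_num) (hnn y)
  have hsum : (C.card : ℝ) / 2 * exp S₁ * exp S₂ ≤ (∑ x ∈ C, ((E x).card : ℝ)) * exp S₃ := by
    calc (C.card : ℝ) / 2 * exp S₁ * exp S₂
        ≤ (∑ x ∈ C, ((goodSide q Q J C x).card : ℝ)) * exp S₂ :=
          mul_le_mul_of_nonneg_right hgood (exp_pos _).le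
      _ ≤ _ := by
          rw [Finset.sum_mul, Finset.sum_mul]
          exact Finset.sum_le_sum fun x _ => hcount x
  have hsumE : (C.card : ℝ) / 2 * exp (S₁ + S₂ - S₃) ≤ ∑ x ∈ C, ((E x).card : ℝ) := by
    rw [exp_sub, exp_add, ← mul_div_assoc, div_le_iff₀ (exp_pos _), ← mul_assoc]
    exact hsum
  have hfinal : (1 / 4 : ℝ) * exp (S₁ + S₂ - S₃ + S₄) ≤ errorProb q W C := by
    have h1 := Finset.sum_le_sum fun x (_ : x ∈ C) => herr x
    rw [← Finset.sum_mul] at h1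
    have h2 := (mul_le_mul_of_nonneg_right hsumE (by positivity : 0 ≤ exp S₄ * (1 / 2))).trans h1
    rw [errorProb, one_div_mul_eq_div (C.card : ℝ), le_div_iff₀ hCpos]
    refine le_trans (le_of_eq ?_) h2
    rw [exp_add _ S₄]; ring
  have hquarter : exp (-2 * logUnit n) ≤ 1 / 4 := by
    have h3 := add_one_le_exp (logUnit n)
    have h4 : exp (-2 * logUnit n) = (exp (logUnit n) ^ 2)⁻¹ := by
      rw [← exp_nat_mul, ← exp_neg]; congr 1; push_cast; ring
    rw [h4, ← one_div]
    exact one_div_le_one_div_of_le (by norm_num) (by nlinarith)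
  refine le_trans ?_ hfinal
  refine le_trans ?_ (mul_le_mul_of_nonneg_right hquarter (exp_pos _).le)
  rw [← exp_add]
  refine exp_le_exp.mpr ?_
  rw [mul_condDiv_eq (n : ℝ) (isChannel_margY hQ.1) hPW]
  have h5 : (Fintype.card X * Fintype.card Y * (Fintype.card Z * (Fintype.card X + 1)) * |log w| :
      ℝ) ≤ Fintype.card X * Fintype.card Y * (Fintype.card Z * (Fintype.card X + 1)) * |log w| *
        logUnit n := le_mul_of_one_le_right (by positivity) hL
  simp only [hS₁, hS₂, hS₃, hS₄, exponentConst]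
  linarith

end Main

theorem logUnit_div_isBigO (c : ℝ) :
    (fun n : ℕ => c * logUnit n / n) =O[Filter.atTop] (fun n : ℕ => Real.log n / n) := by
  refine Asymptotics.IsBigO.of_bound (|c| * 2) ?_
  filter_upwards [Filter.eventually_ge_atTop 3] with n hn
  have hn' : (3 : ℝ) ≤ n := by exact_mod_cast hn
  have h1 : 1 ≤ log n := by
    rw [le_log_iff_exp_le (by linarith)]
    linarith [exp_one_lt_d9]
  have h0 : 0 ≤ logUnit n := zero_le_one.trans (one_le_logUnit n)
  rw [norm_div, norm_div, norm_mul, Real.norm_eq_abs, Real.norm_of_nonneg h0,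
    Real.norm_of_nonneg (by linarith : (0 : ℝ) ≤ log n), ← mul_div_assoc]
  refine div_le_div_of_nonneg_right ?_ (norm_nonneg _)
  rw [mul_assoc]
  refine mul_le_mul_of_nonneg_left ?_ (abs_nonneg _)
  unfold logUnit; linarith

/-- The bound at block length `n`, with the explicit loss terms. -/
theorem bestExponent_le_spherePacking {X Y Z : Type*} [Fintype X] [Fintype Y] [Fintype Z] {w : ℝ}
    (hw0 : 0 < w) {W : X → Y → ℝ} (hW : IsChannel W) (hw : ∀ a b, 0 < W a b → w ≤ W a b)
    (q : X → Y → ℝ) {n : ℕ} (hn : 0 < n) {P : X → ℝ} (hPn : IsType n P) (R : ℝ) :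
    bestExponent q n R P W ≤
      spherePacking Z q (R - rateConst X Z * logUnit n / n) P W +
        ((exponentConst X Y Z w * logUnit n / n : ℝ) : EReal) := by
  obtain ⟨x₁, hx₁⟩ := hPn
  have hn' : (0 : ℝ) < n := by exact_mod_cast hn
  have hcount : ∀ x : Fin n → X, empirical x = P → ∀ a, (count x a : ℝ) = n * P a := by
    rintro x rfl a
    rw [empirical, mul_div_cancel₀ _ hn'.ne', count]
  have hP : P ∈ stdSimplex ℝ X := by
    refine ⟨fun a => ?_, ?_⟩
    · rw [← hx₁, empirical]; positivity
    · have h := sum_count x₁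
      have h' : ∑ a, (count x₁ a : ℝ) = n := by exact_mod_cast h
      simp only [hcount x₁ hx₁, ← Finset.mul_sum] at h'
      exact mul_left_cancel₀ hn'.ne' (h'.trans (mul_one _).symm)
  refine iSup₂_le fun C hC => ?_
  obtain ⟨hCP, hR⟩ := hC
  rw [← EReal.sub_le_iff_le_add (Or.inl (EReal.coe_ne_bot _)) (Or.inl (EReal.coe_ne_top _))]
  refine le_iInf₂ fun Q hQ => ?_
  rw [EReal.sub_le_iff_le_add (Or.inl (EReal.coe_ne_bot _)) (Or.inl (EReal.coe_ne_top _))]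
  obtain ⟨hQ, hI⟩ := hQ
  rw [condDiv]
  split_ifs with hPW
  swap
  · rw [EReal.top_add_coe]; exact le_top
  -- there is no channel into an empty alphabet
  have hZ : Nonempty Z := by
    by_contra hne
    rw [not_nonempty_iff] at hne
    have := (hQ.1 (x₁ ⟨0, hn⟩)).2
    simp at this
  have hI' : n * mutualInfo (fun x z => P x * margZ Q x z) + rateConst X Z * logUnit n ≤ n * R := by
    have h := mul_le_mul_of_nonneg_left hI hn'.le
    rw [mul_sub, mul_div_cancel₀ _ hn'.ne'] at h
    linarith
  have h := le_errorProb hn hP hW hw0 hw hQ hPW (fun x hx => hcount x (hCP x hx)) hR hI'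
  have hpos : 0 < errorProb q W C := (Real.exp_pos _).trans_le h
  rw [exponent, if_neg hpos.ne', ← EReal.coe_add, EReal.coe_le_coe_iff]
  have hlog := (Real.le_log_iff_exp_le hpos).mpr h
  rw [← sub_nonneg]
  refine nonneg_of_mul_nonneg_right ?_ hn'
  have e : ∀ A B L : ℝ, n * (A + B / n - -(1 / (n : ℝ)) * L) = n * A + B + L := fun A B L => by
    field_simp
    ring
  rw [e]
  linarith

end MismatchedDecoding

end

theorem theorem2 (X Y Z : Type*) [Fintype X] [Fintype Y] [Fintype Z] :
    ∃ εa : ℕ → ℝ, εa =O[Filter.atTop] (fun n : ℕ => Real.log n / n) ∧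
      ∀ w : ℝ, 0 < w →
        ∃ εb : ℕ → ℝ, εb =O[Filter.atTop] (fun n : ℕ => Real.log n / n) ∧
          ∀ W : X → Y → ℝ, MismatchedDecoding.IsChannel W →
            (∀ x y, 0 < W x y → w ≤ W x y) →
            ∀ (q : X → Y → ℝ) (n : ℕ), 0 < n →
              ∀ P : X → ℝ, MismatchedDecoding.IsType n P →
                ∀ R : ℝ,
                  MismatchedDecoding.bestExponent q n R P W ≤
                    MismatchedDecoding.spherePacking Z q (R - εa n) P W + (εb n : EReal) := by
  exact ⟨fun n => MismatchedDecoding.rateConst X Z * MismatchedDecoding.logUnit n / n,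
    MismatchedDecoding.logUnit_div_isBigO _, fun w hw0 =>
    ⟨fun n => MismatchedDecoding.exponentConst X Y Z w * MismatchedDecoding.logUnit n / n,
      MismatchedDecoding.logUnit_div_isBigO _, fun _ hW hw q _ hn _ hP R =>
      MismatchedDecoding.bestExponent_le_spherePacking hw0 hW hw q hn hP R⟩⟩
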